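/- Conventions. Let $A$ be a unital $C^*$-algebra and $M_\infty(A)=\bigcup_n M_n(A)$, where $a\in M_n(A)$ is identified with $\mathrm{diag}(a,0)\in M_{n+1}(A)$. For positive elements $a,b$ of a $C^*$-algebra $C$ write $a\precsim b$ if there is a sequence $(r_n)$ in $C$ with $\lim_{n\to\infty}\|r_n b r_n^*-a\|=0$. For $a\in M_n(A)_+$ and $b\in M_p(A)_+$ write $\langle a\rangle\le\langle b\rangle$ if $a\precsim b$ in $M_{\max(n,p)}(A)$ after padding with zeros, and let $k\langle b\rangle$ denote the class of the $k$-fold direct sum $b\oplus\cdots\oplus b$. For $a\ge 0$ and $\varepsilon>0$ let $(a-\varepsilon)_+=f(a)$ with $f(t)=\max(0,t-\varepsilon)$. For $m\in\mathbb N=\{0,1,2,\dots\}$, $A$ is called *$m$-almost divisible* if for all $a\in M_\infty(A)_+$, $k\in\mathbb N$ and $\varepsilon>0$ there is $b\in M_\infty(A)_+$ with $k\langle b\rangle\le\langle a\rangle$ and $\langle (a-\varepsilon)_+\rangle\le (k+1)(m+1)\langle b\rangle$. Let $\mathcal P$ be a class of unital $C^*$-algebras. $A$ is called *asymptotically tracially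 in $\mathcal P$* if for every $\varepsilon>0$, every finite subset $F\subseteq A$ and every nonzero $a\in A_+$ there exist $B\in\mathcal P$ and completely positive contractive linear maps $\alpha:A\to B$, $\beta_n:B\to A$ and $\gamma_n:A\to A$ ($n\in\mathbb N$) such that 1. $\|x-\gamma_n(x)-\beta_n(\alpha(x))\|<\varepsilon$ for all $x\in F$ and all $n\in\mathbb N$; 2. $\|\alpha(xy)-\alpha(x)\alpha(y)\|<\varepsilon$ and $\bigl|\|\alpha(x)\|-\|x\|\bigr|<\varepsilon$ for all $x,y\in F$; 3. $\lim_{n\to\infty}\|\beta_n(xy)-\beta_n(x)\beta_n(y)\|=0$ and $\lim_{n\to\infty}\|\beta_n(x)\|=\|x\|$ for all $x,y\in B$; 4. $\gamma_n(1_A)\precsim a$ in $A$ for all $n\in\mathbb N$. **Theorem.** Let $m\in\mathbb N$ and let $\mathcal P$ be a class of unital $C^*$-algebras each of which is $m$-almost divisible. Let $A$ be a unital separable simple $C^*$-algebra. If $A$ is asymptotically tracially in $\mathcal P$, then $A$ is $m$-almost divisible. -/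

import Mathlib

open Filter Topology

universe u v

namespace AsympTracial

/-- Cuntz subequivalence `a ≾ b` in a C⋆-algebra: there is a sequence `rₙ` with
`‖rₙ b rₙ* - a‖ → 0`. -/
def CuntzLE {A : Type*} [NonUnitalCStarAlgebra A] (a b : A) : Prop :=
  ∃ r : ℕ → A, Tendsto (fun n => ‖r n * b * star (r n) - a‖) atTop (𝓝 0)

/-- The functional calculus element `(a - ε)₊`, given by `t ↦ max 0 (t - ε)`. -/
noncomputable def cutDown {A : Type*} [CStarAlgebra A] (a : A) (ε : ℝ) : A :=
  cfc (fun t : ℝ => max 0 (t - ε)) a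

section Matrices

variable {A : Type*} [CStarAlgebra A]

/-- `diag(a, 0) ∈ M_N(A)` for `a ∈ M_n(A)`; it is only used for `n ≤ N`. -/
def pad {n : ℕ} (N : ℕ) (a : CStarMatrix (Fin n) (Fin n) A) : CStarMatrix (Fin N) (Fin N) A :=
  CStarMatrix.ofMatrix fun i j =>
    if h : (i : ℕ) < n ∧ (j : ℕ) < n then a ⟨i, h.1⟩ ⟨j, h.2⟩ else 0

/-- `a ⊕ b = diag(a, b) ∈ M_{n+m}(A)`. -/
def directSum {n m : ℕ} (a : CStarMatrix (Fin n) (Fin n) A) (b : CStarMatrix (Fin m) (Fin m) A) :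
    CStarMatrix (Fin (n + m)) (Fin (n + m)) A :=
  CStarMatrix.ofMatrix (Matrix.reindex finSumFinEquiv finSumFinEquiv
    (Matrix.fromBlocks (CStarMatrix.ofMatrix.symm a) 0 0 (CStarMatrix.ofMatrix.symm b)))

/-- The `k`-fold direct sum `b ⊕ ⋯ ⊕ b`, which represents `k⟨b⟩`. -/
def copies {n : ℕ} (b : CStarMatrix (Fin n) (Fin n) A) :
    (k : ℕ) → CStarMatrix (Fin (n * k)) (Fin (n * k)) A
  | 0 => 0
  | k + 1 => directSum (copies b k) b

variable [PartialOrder A] [StarOrderedRing A]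

/-- Cuntz subequivalence in `M_∞(A)`, i.e. the relation `⟨a⟩ ≤ ⟨b⟩`: matrices of different sizes
are compared after padding both with zeros to the larger of the two sizes. -/
def MatCuntzLE {n m : ℕ} (a : CStarMatrix (Fin n) (Fin n) A)
    (b : CStarMatrix (Fin m) (Fin m) A) : Prop :=
  CuntzLE (pad (max n m) a) (pad (max n m) b)

end Matrices

/-- `A` is `m`-almost divisible: for all `a ∈ M_∞(A)₊`, `k ∈ ℕ`, `ε > 0` there is `b ∈ M_∞(A)₊`
with `k⟨b⟩ ≤ ⟨a⟩` and `⟨(a - ε)₊⟩ ≤ (k + 1)(m + 1)⟨b⟩`. -/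
def AlmostDivisible (m : ℕ) (A : Type*) [CStarAlgebra A] [PartialOrder A] [StarOrderedRing A] :
    Prop :=
  ∀ (n : ℕ) (a : CStarMatrix (Fin n) (Fin n) A), 0 ≤ a → ∀ (k : ℕ) (ε : ℝ), 0 < ε →
    ∃ (p : ℕ) (b : CStarMatrix (Fin p) (Fin p) A), 0 ≤ b ∧
      MatCuntzLE (copies b k) a ∧
      MatCuntzLE (cutDown a ε) (copies b ((k + 1) * (m + 1)))

/-- Simplicity of a C⋆-algebra: nonzero, with no closed two-sided ideals other than `0` and the
whole algebra. -/
def IsSimpleCStar (A : Type*) [CStarAlgebra A] : Prop :=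
  Nontrivial A ∧ ∀ I : TwoSidedIdeal A, IsClosed (I : Set A) → I = ⊥ ∨ I = ⊤

/-- `φ` is a `G`-`ε`-approximate embedding. -/
def IsApproxEmbedding {A B : Type*} [CStarAlgebra A] [CStarAlgebra B] (φ : A → B) (G : Set A)
    (ε : ℝ) : Prop :=
  (∀ x ∈ G, ∀ y ∈ G, ‖φ (x * y) - φ x * φ y‖ < ε) ∧ ∀ x ∈ G, |‖φ x‖ - ‖x‖| < ε

/-- A map between normed spaces is contractive. -/
def IsContractive {A B : Type*} [Norm A] [Norm B] (φ : A → B) : Prop :=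
  ∀ x, ‖φ x‖ ≤ ‖x‖

open scoped CStarAlgebra in
/-- `A` is asymptotically tracially in the class `P` of unital C⋆-algebras. (The order on a
C⋆-algebra is uniquely determined by `StarOrderedRing`, so `P` is a class of C⋆-algebras.) -/
def AsymptoticallyTraciallyIn
    (P : (B : Type v) → [CStarAlgebra B] → [PartialOrder B] → [StarOrderedRing B] → Prop)
    (A : Type u) [CStarAlgebra A] [PartialOrder A] [StarOrderedRing A] : Prop :=
  ∀ (ε : ℝ), 0 < ε → ∀ (F : Finset A) (a : A), 0 ≤ a → a ≠ 0 →
    ∃ (B : Type v) (_ : CStarAlgebra B) (_ : PartialOrder B) (_ : StarOrderedRing B)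
      (α : A →CP B) (β : ℕ → (B →CP A)) (γ : ℕ → (A →CP A)),
      P B ∧
      IsContractive α ∧ (∀ n, IsContractive (β n)) ∧ (∀ n, IsContractive (γ n)) ∧
      (∀ x ∈ F, ∀ n, ‖x - γ n x - β n (α x)‖ < ε) ∧
      IsApproxEmbedding α (F : Set A) ε ∧
      (∀ x y : B, Tendsto (fun n => ‖β n (x * y) - β n x * β n y‖) atTop (𝓝 0)) ∧
      (∀ x : B, Tendsto (fun n => ‖β n x‖) atTop (𝓝 ‖x‖)) ∧
      ∀ n, CuntzLE (γ n 1) a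

end AsympTracial

/-! Two rounds of the tracial approximation produce the divisor. Applied to the entries of `a`, the
approximation gives `a ≈ x + y` with `x = β(α(a))` and `y = γ(a)`. Divisibility of `B` passes
through `β` to give `b₁` dividing `x`, but the size of the remainder `y` relative to `b₁` is
unknown, because `b₁` appears only after the approximation is chosen. Hence `y` is split again as `y
≈ z + w`, this time with `γ(1)` below a nonzero diagonal entry of `b₁`. Then `z` is divided by some
`b₂`, while `⟨w⟩ ≤ n⟨b₁⟩`. Dividing `x` by `k(n+1)` instead of `k` leaves room to absorb `w`: the
divisor of `a` is `b = (n+1)b₁ ⊕ b₂`, and `(k(n+1)+1)(m+1) + n ≤ (k+1)(n+1)(m+1)`.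

The lower estimate needs `⟨x⟩ + ⟨y⟩ ≤ ⟨a⟩` up to cutting down, although `x` and `y` are not
orthogonal. They are almost orthogonal: `x` is dominated by a multiple of the almost projection
`β(α(1))`, and `y` by a multiple of its approximate complement `γ(1)`, so `√x √y` is small
(`norm_sqrt_mul_sqrt_le`). For the row `v = (√x, √y)`, `v v* = x + y` while `v* v ≈ diag(x, y)`,
which yields the comparison (`cls_cutDown_add_cls_cutDown_le`).

Completely positive maps do not respect functional calculus, so estimates are transported as order
inequalities `x ≤ r y r* + δ·1` and converted to Cuntz comparisons only in the target algebra,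
through `cutDown_mem_closure_conj`. `AlmostDivisible.eventually_exists` carries out this transport
and `AsymptoticallyTraciallyIn.exists_splitting` packages one round. -/

namespace AsympTracial

/-! ### Cuntz comparison, cut-downs and almost orthogonality in a single C⋆-algebra -/

section Abstract

variable {C : Type*} [CStarAlgebra C]

/-- `a ≾ b` means that `a` is a limit of conjugates of `b`. -/
theorem cuntzLE_iff_mem_closure {a b : C} :
    CuntzLE a b ↔ a ∈ closure (Set.range fun r : C => r * b * star r) := by
  rw [mem_closure_iff_seq_limit]
  constructor
  · rintro ⟨r, hr⟩
    exact ⟨fun n => r n * b * star (r n), fun n => ⟨r n, rfl⟩,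
      tendsto_iff_norm_sub_tendsto_zero.2 hr⟩
  · rintro ⟨x, hx, hlim⟩
    choose r hr using hx
    refine ⟨r, ?_⟩
    have := tendsto_iff_norm_sub_tendsto_zero.1 hlim
    simpa only [← hr] using this

theorem isSelfAdjoint_smul_one (δ : ℝ) : IsSelfAdjoint (δ • (1 : C)) :=
  (IsSelfAdjoint.all δ).smul (.one C)

theorem cutDown_eq_posPart {x : C} (hx : IsSelfAdjoint x) (δ : ℝ) :
    cutDown x δ = (x - δ • (1 : C))⁺ := by
  have h1 : x - δ • (1 : C) = cfc (fun t : ℝ => t - δ) x := by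
    rw [cfc_sub (fun t : ℝ => t) (fun _ => δ) x, cfc_id' ℝ x, cfc_const δ x,
      Algebra.algebraMap_eq_smul_one]
  have h2 : (x - δ • (1 : C))⁺ = cfc (fun t : ℝ => t⁺) (x - δ • (1 : C)) := by
    rw [CFC.posPart_def, cfcₙ_eq_cfc]
  rw [h2, h1, ← cfc_comp' (fun t : ℝ => t⁺) (fun t : ℝ => t - δ) x]
  refine cfc_congr fun t _ => ?_
  simp only [posPart_def]
  exact max_comm _ _

variable [PartialOrder C] [StarOrderedRing C]

theorem exists_eq_star_mul_self {x : C} (hx : 0 ≤ x) : ∃ s : C, x = star s * s :=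
  CStarAlgebra.nonneg_iff_eq_star_mul_self.1 hx

theorem le_add_of_norm_sub_le {x y : C} (hx : IsSelfAdjoint x) (hy : IsSelfAdjoint y) {δ : ℝ}
    (h : ‖x - y‖ ≤ δ) : x ≤ y + δ • (1 : C) := by
  have h1 := (hx.sub hy).le_algebraMap_norm_self
  have h2 : algebraMap ℝ C ‖x - y‖ ≤ algebraMap ℝ C δ := algebraMap_mono C h
  rw [← Algebra.algebraMap_eq_smul_one]
  exact sub_le_iff_le_add'.1 (h1.trans h2)

theorem le_smul_one_of_norm_le {x : C} (hx : IsSelfAdjoint x) {δ : ℝ} (h : ‖x‖ ≤ δ) :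
    x ≤ δ • (1 : C) := by
  have := le_add_of_norm_sub_le hx (.zero C) (δ := δ) (by rwa [sub_zero])
  rwa [zero_add] at this

theorem norm_le_of_le_smul_one {x : C} (hx : 0 ≤ x) {δ : ℝ} (hδ : 0 ≤ δ)
    (h : x ≤ δ • (1 : C)) : ‖x‖ ≤ δ := by
  rwa [CStarAlgebra.norm_le_iff_le_algebraMap x hδ, Algebra.algebraMap_eq_smul_one]

theorem norm_sqrt_mul_sqrt_sq {x y : C} (hy : 0 ≤ y) :
    ‖CFC.sqrt x * CFC.sqrt y‖ ^ 2 = ‖CFC.sqrt x * y * CFC.sqrt x‖ := by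
  have h1 : IsSelfAdjoint (CFC.sqrt x) := .of_nonneg (CFC.sqrt_nonneg x)
  have h2 : IsSelfAdjoint (CFC.sqrt y) := .of_nonneg (CFC.sqrt_nonneg y)
  rw [sq, ← CStarRing.norm_self_mul_star, star_mul, h1.star_eq, h2.star_eq]
  congr 1
  calc _ = CFC.sqrt x * (CFC.sqrt y * CFC.sqrt y) * CFC.sqrt x := by noncomm_ring
    _ = _ := by rw [CFC.sqrt_mul_sqrt_self y]

theorem norm_sqrt_mul_sqrt_comm (x y : C) :
    ‖CFC.sqrt x * CFC.sqrt y‖ = ‖CFC.sqrt y * CFC.sqrt x‖ := by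
  have h1 : IsSelfAdjoint (CFC.sqrt x) := .of_nonneg (CFC.sqrt_nonneg x)
  have h2 : IsSelfAdjoint (CFC.sqrt y) := .of_nonneg (CFC.sqrt_nonneg y)
  rw [← norm_star, star_mul, h1.star_eq, h2.star_eq]

theorem norm_sqrt_mul_sqrt_sq_le {x y z : C} (hy : 0 ≤ y) {M : ℝ}
    (hz : 0 ≤ z) (hM : 0 ≤ M) (hyz : y ≤ M • z) :
    ‖CFC.sqrt x * CFC.sqrt y‖ ^ 2 ≤ M * ‖CFC.sqrt x * CFC.sqrt z‖ ^ 2 := by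
  have h1 : IsSelfAdjoint (CFC.sqrt x) := .of_nonneg (CFC.sqrt_nonneg x)
  rw [norm_sqrt_mul_sqrt_sq hy, norm_sqrt_mul_sqrt_sq hz]
  have h2 : CFC.sqrt x * y * CFC.sqrt x ≤ CFC.sqrt x * (M • z) * CFC.sqrt x :=
    h1.conjugate_le_conjugate hyz
  have h3 : CFC.sqrt x * (M • z) * CFC.sqrt x = M • (CFC.sqrt x * z * CFC.sqrt x) := by
    simp
  rw [h3] at h2
  refine (CStarAlgebra.norm_le_norm_of_nonneg_of_le (h1.conjugate_nonneg hy) h2).trans ?_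
  rw [norm_smul, Real.norm_of_nonneg hM]

/-- Elements dominated by an almost projection and by its complement are almost orthogonal. -/
theorem norm_sqrt_mul_sqrt_le {x y e g : C} {M ε : ℝ} (hx : 0 ≤ x) (hy : 0 ≤ y)
    (he : 0 ≤ e) (hg : 0 ≤ g) (he1 : e ≤ 1) (hM : 0 ≤ M) (hε : 0 ≤ ε)
    (hxe : x ≤ M • e) (hyg : y ≤ M • g) (heg : e + g ≤ 1 + ε • (1 : C)) :
    ‖CFC.sqrt x * CFC.sqrt y‖ ^ 2 ≤ M * (M * (‖e - e * e‖ + ε)) := by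
  refine (norm_sqrt_mul_sqrt_sq_le hy hg hM hyg).trans ?_
  refine mul_le_mul_of_nonneg_left ?_ hM
  rw [norm_sqrt_mul_sqrt_comm]
  refine (norm_sqrt_mul_sqrt_sq_le hx he hM hxe).trans ?_
  refine mul_le_mul_of_nonneg_left ?_ hM
  -- With `y` replaced by `g` and `x` by `e`, it remains to bound `√e g √e ≤ √e (1 + ε - e) √e = e -
  -- e² + ε e`.
  rw [norm_sqrt_mul_sqrt_comm, norm_sqrt_mul_sqrt_sq hg]
  have h1 : IsSelfAdjoint (CFC.sqrt e) := .of_nonneg (CFC.sqrt_nonneg e)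
  have h2 : g ≤ 1 + ε • (1 : C) - e := le_sub_iff_add_le'.2 heg
  have h3 := h1.conjugate_le_conjugate h2
  have h4 : CFC.sqrt e * (1 + ε • (1 : C) - e) * CFC.sqrt e = (e - e * e) + ε • e := by
    have hs := CFC.sqrt_mul_sqrt_self e
    have h5 : CFC.sqrt e * e * CFC.sqrt e = e * e := by
      calc _ = CFC.sqrt e * (CFC.sqrt e * CFC.sqrt e) * CFC.sqrt e := by rw [hs]
        _ = (CFC.sqrt e * CFC.sqrt e) * (CFC.sqrt e * CFC.sqrt e) := by noncomm_ring
        _ = _ := by rw [hs]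
    rw [mul_sub, sub_mul, h5, mul_add, add_mul, mul_one, hs]
    simp only [mul_smul_comm, mul_one, smul_mul_assoc, hs]
    abel
  rw [h4] at h3
  refine (CStarAlgebra.norm_le_norm_of_nonneg_of_le (h1.conjugate_nonneg hg) h3).trans ?_
  refine (norm_add_le _ _).trans (add_le_add le_rfl ?_)
  rw [norm_smul, Real.norm_of_nonneg hε]
  have : ‖e‖ ≤ 1 := (CStarAlgebra.norm_le_one_iff_of_nonneg e).2 he1
  exact mul_le_of_le_one_right hε this

/-- Square roots of elements dominated by an almost projection and by its complement. -/
theorem exists_sqrt_norm_mul_le {x y e g : C} {M ε κ : ℝ} (hx : 0 ≤ x) (hy : 0 ≤ y)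
    (he : 0 ≤ e) (hg : 0 ≤ g) (he1 : e ≤ 1) (hM : 0 ≤ M) (hε : 0 ≤ ε) (hκ : 0 ≤ κ)
    (hxe : x ≤ M • e) (hyg : y ≤ M • g) (heg : e + g ≤ 1 + ε • (1 : C))
    (h : M * (M * (‖e - e * e‖ + ε)) ≤ κ ^ 2) :
    ∃ s t : C, IsSelfAdjoint s ∧ IsSelfAdjoint t ∧ s * s = x ∧ t * t = y ∧ ‖s * t‖ ≤ κ :=
  ⟨CFC.sqrt x, CFC.sqrt y, .of_nonneg (CFC.sqrt_nonneg x), .of_nonneg (CFC.sqrt_nonneg y),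
    CFC.sqrt_mul_sqrt_self x, CFC.sqrt_mul_sqrt_self y,
    (sq_le_sq₀ (norm_nonneg _) hκ).1
      ((norm_sqrt_mul_sqrt_le hx hy he hg he1 hM hε hxe hyg heg).trans h)⟩

/-- Conjugation by `√x (y + δ)^(-1/2)` sends `y` to `x - √x Q² √x` with `Q² = δ/(y + δ)`. The
C⋆-identity turns the norm of the error into `‖Q x Q‖ ≤ ‖Q y Q‖ ≤ δ`. -/
theorem mem_closure_conj_of_le {x y : C} (hx : 0 ≤ x) (hxy : x ≤ y) :
    x ∈ closure (Set.range fun r : C => r * y * star r) := by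
  have hy : 0 ≤ y := hx.trans hxy
  rw [Metric.mem_closure_range_iff]
  intro ε hε
  set δ := ε / 2 with hδ
  have hδ0 : 0 < δ := by positivity
  -- The absolute value makes `h` and `q` continuous on all of `ℝ`; on the spectrum of `y` it
  -- disappears.
  set h : ℝ → ℝ := fun t => Real.sqrt (1 / (|t| + δ))
  set q : ℝ → ℝ := fun t => Real.sqrt (δ / (|t| + δ))
  have hpos : ∀ t : ℝ, |t| + δ ≠ 0 := fun t => by positivity
  have hcont : Continuous h := by fun_prop (disch := exact hpos _)
  have qcont : Continuous q := by fun_prop (disch := exact hpos _)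
  set s := CFC.sqrt x
  have hs : IsSelfAdjoint s := .of_nonneg (CFC.sqrt_nonneg x)
  have hss : s * s = x := CFC.sqrt_mul_sqrt_self x
  set H := cfc h y
  set Q := cfc q y
  have hH : IsSelfAdjoint H := cfc_predicate _ _
  have hQ : IsSelfAdjoint Q := cfc_predicate _ _
  have hysa : IsSelfAdjoint y := .of_nonneg hy
  have key : 1 - H * y * H = Q * Q := by
    have e1 : H * y * H = cfc (fun t => h t * t * h t) y := by
      rw [cfc_mul (fun t => h t * t) h y, cfc_mul h (fun t => t) y, cfc_id' ℝ y]
    rw [e1, ← cfc_mul q q y, ← cfc_one ℝ y, ← cfc_sub (1 : ℝ → ℝ) _ y]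
    refine cfc_congr fun t ht => ?_
    have ht0 : 0 ≤ t := spectrum_nonneg_of_nonneg hy ht
    have h1 : h t * h t = 1 / (|t| + δ) := Real.mul_self_sqrt (by positivity)
    have h2 : q t * q t = δ / (|t| + δ) := Real.mul_self_sqrt (by positivity)
    have h3 : h t * t * h t = t * (h t * h t) := by ring
    simp only [h3, h1, h2, Pi.one_apply, abs_of_nonneg ht0]
    have : t + δ ≠ 0 := by positivity
    field_simp
    ring
  refine ⟨s * H, ?_⟩
  have e2 : x - s * H * y * star (s * H) = s * (Q * Q) * s := by
    rw [← key, star_mul, hH.star_eq, hs.star_eq, mul_sub, sub_mul, mul_one, hss]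
    noncomm_ring
  rw [dist_eq_norm, e2]
  have e3 : ‖s * (Q * Q) * s‖ = ‖Q * x * Q‖ := by
    have a1 : s * (Q * Q) * s = (s * Q) * star (s * Q) := by
      rw [star_mul, hQ.star_eq, hs.star_eq]; noncomm_ring
    have a2 : Q * x * Q = star (s * Q) * (s * Q) := by
      rw [star_mul, hQ.star_eq, hs.star_eq, ← hss]; noncomm_ring
    rw [a1, a2, CStarRing.norm_self_mul_star, CStarRing.norm_star_mul_self]
  rw [e3]
  have e4 : ‖Q * x * Q‖ ≤ ‖Q * y * Q‖ :=
    CStarAlgebra.norm_le_norm_of_nonneg_of_le (hQ.conjugate_nonneg hx)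
      (hQ.conjugate_le_conjugate hxy)
  have e5 : Q * y * Q = cfc (fun t => q t * t * q t) y := by
    rw [cfc_mul (fun t => q t * t) q y, cfc_mul q (fun t => t) y, cfc_id' ℝ y]
  have e6 : ‖Q * y * Q‖ ≤ δ := by
    rw [e5]
    refine norm_cfc_le hδ0.le fun t ht => ?_
    have ht0 : 0 ≤ t := spectrum_nonneg_of_nonneg hy ht
    have h2 : q t * q t = δ / (|t| + δ) := Real.mul_self_sqrt (by positivity)
    have h3 : q t * t * q t = t * (q t * q t) := by ring
    rw [h3, h2, abs_of_nonneg ht0, Real.norm_of_nonneg (by positivity), ← mul_div_assoc,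
      div_le_iff₀ (by positivity)]
    nlinarith
  calc _ ≤ δ := e4.trans e6
    _ < ε := by linarith

theorem cutDown_nonneg (x : C) (δ : ℝ) : 0 ≤ cutDown x δ :=
  cfc_nonneg fun _ _ => le_max_left _ _

theorem le_cutDown_add {x : C} (hx : IsSelfAdjoint x) (δ : ℝ) :
    x ≤ cutDown x δ + δ • (1 : C) := by
  rw [cutDown_eq_posPart hx, ← sub_le_iff_le_add]
  exact CFC.le_posPart (hx.sub (isSelfAdjoint_smul_one δ))

theorem sub_le_cutDown {x : C} (hx : IsSelfAdjoint x) (δ : ℝ) :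
    x - δ • (1 : C) ≤ cutDown x δ := sub_le_iff_le_add.2 (le_cutDown_add hx δ)

theorem cutDown_eq_zero_of_le {x : C} (hx : IsSelfAdjoint x) {δ : ℝ} (h : x ≤ δ • (1 : C)) :
    cutDown x δ = 0 := by
  rw [cutDown_eq_posPart hx, CFC.posPart_eq_zero_iff _
    (hx.sub (isSelfAdjoint_smul_one δ))]
  exact sub_nonpos.2 h

theorem exists_sub_eq_cutDown_sub {x : C} (hx : IsSelfAdjoint x) (δ : ℝ) :
    ∃ q : C, 0 ≤ q ∧ x - δ • (1 : C) = cutDown x δ - q ∧ cutDown x δ * q = 0 := by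
  rw [cutDown_eq_posPart hx]
  exact ⟨_, CFC.negPart_nonneg _,
    (CFC.posPart_sub_negPart _ (hx.sub (isSelfAdjoint_smul_one δ))).symm,
    CFC.posPart_mul_negPart _⟩

/-- Uniqueness of the orthogonal decomposition into positive and negative parts identifies cut-downs
algebraically, as needed for direct sums. -/
theorem cutDown_eq_of_sub_eq {x p q : C} {δ : ℝ} (hx : IsSelfAdjoint x) (hp : 0 ≤ p)
    (hq : 0 ≤ q) (h : x - δ • (1 : C) = p - q) (hpq : p * q = 0) : cutDown x δ = p := by
  rw [cutDown_eq_posPart hx]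
  exact (CFC.posPart_negPart_unique h hpq hp hq).1

theorem exists_conj_sub_near_cutDown {x : C} (hx : IsSelfAdjoint x) (δ : ℝ) {ε : ℝ}
    (hε : 0 < ε) :
    ∃ g : C, 0 ≤ g * (x - δ • (1 : C)) * star g ∧
      ‖g * (x - δ • (1 : C)) * star g - cutDown x δ‖ ≤ ε := by
  -- A ramp from 0 at `δ` to 1 at `δ + ε`: it kills the negative part of `x - δ` and alters the
  -- positive part only where that is at most `ε`.
  set f : ℝ → ℝ := fun t => min 1 (max 0 ((t - δ) / ε))
  have fcont : Continuous f := by fun_prop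
  have hf : IsSelfAdjoint (cfc f x) := cfc_predicate _ _
  have h1 : x - δ • (1 : C) = cfc (fun t : ℝ => t - δ) x := by
    rw [cfc_sub (fun t : ℝ => t) (fun _ => δ) x, cfc_id' ℝ x, cfc_const δ x,
      Algebra.algebraMap_eq_smul_one]
  have h2 : cfc f x * (x - δ • (1 : C)) * star (cfc f x)
      = cfc (fun t => f t * (t - δ) * f t) x := by
    rw [hf.star_eq, h1, cfc_mul (fun t => f t * (t - δ)) f x, cfc_mul f (fun t => t - δ) x]
  have hbound : ∀ t : ℝ, 0 ≤ f t * (t - δ) * f t ∧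
      |f t * (t - δ) * f t - max 0 (t - δ)| ≤ ε := by
    intro t
    rcases le_total (t - δ) 0 with h | h
    · have : f t = 0 := by
        simp only [f]
        rw [max_eq_left (div_nonpos_of_nonpos_of_nonneg h hε.le)]
        simp
      simp [this, h, hε.le]
    · have h3 : max 0 ((t - δ) / ε) = (t - δ) / ε := max_eq_right (by positivity)
      rcases le_total (t - δ) ε with h4 | h4
      · have h5 : (t - δ) / ε ≤ 1 := (div_le_one hε).2 h4
        have h6 : f t = (t - δ) / ε := by simp only [f]; rw [h3, min_eq_right h5]
        have h7 : 0 ≤ f t := by rw [h6]; positivity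
        have h8 : f t ≤ 1 := by rw [h6]; exact h5
        refine ⟨by positivity, ?_⟩
        rw [max_eq_right h, abs_le]
        constructor <;> nlinarith [mul_nonneg h7 h, mul_nonneg h7 (mul_nonneg h7 h),
          mul_le_one₀ h8 h7 h8]
      · have h5 : 1 ≤ (t - δ) / ε := (one_le_div hε).2 h4
        have h6 : f t = 1 := by simp only [f]; rw [h3, min_eq_left h5]
        rw [h6, max_eq_right h]
        simp [h, hε.le]
  refine ⟨cfc f x, ?_, ?_⟩
  · rw [h2]
    exact cfc_nonneg fun t _ => (hbound t).1
  · rw [h2, cutDown, ← cfc_sub _ _ x]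
    exact norm_cfc_le hε.le fun t _ => (hbound t).2

theorem cutDown_mem_closure_conj_sub {x : C} (hx : IsSelfAdjoint x) (δ : ℝ) :
    cutDown x δ ∈ closure (Set.range fun r : C => r * (x - δ • (1 : C)) * star r) := by
  rw [Metric.mem_closure_range_iff]
  intro ε hε
  obtain ⟨g, -, hg⟩ := exists_conj_sub_near_cutDown hx δ (half_pos hε)
  refine ⟨g, ?_⟩
  rw [dist_comm, dist_eq_norm]
  linarith

/-- Conjugating `x - δ ≤ y` by the ramp `g` makes the left side positive and close to `cutDown x δ`,
so domination implies comparison. Positivity of `y` is not needed. This is the passage from order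
estimates to Cuntz estimates used throughout. -/
theorem cutDown_mem_closure_conj {x y : C} (hx : IsSelfAdjoint x) {δ : ℝ}
    (h : x ≤ y + δ • (1 : C)) :
    cutDown x δ ∈ closure (Set.range fun r : C => r * y * star r) := by
  rw [← closure_closure, Metric.mem_closure_iff]
  intro ε hε
  obtain ⟨g, hg0, hg⟩ := exists_conj_sub_near_cutDown hx δ (half_pos hε)
  refine ⟨g * (x - δ • (1 : C)) * star g, ?_, ?_⟩
  · have h1 : g * (x - δ • (1 : C)) * star g ≤ g * y * star g :=
      star_right_conjugate_le_conjugate (sub_le_iff_le_add.2 h) g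
    refine closure_mono ?_ (mem_closure_conj_of_le hg0 h1)
    rintro _ ⟨r, rfl⟩
    exact ⟨r * g, by simp only [star_mul, mul_assoc]⟩
  · rw [dist_comm, dist_eq_norm]
    linarith

end Abstract

/-! ### Comparison through rectangular matrices, and coordinate blocks -/

section Rectangular

variable {A : Type*} [CStarAlgebra A]
variable {l m n o : Type*}

namespace Mat

theorem ofMatrix_apply {A : Type*} (f : l → m → A) (i : l) (j : m) :
    (CStarMatrix.ofMatrix f : CStarMatrix l m A) i j = f i j := rfl

theorem mul_assoc [Fintype m] [Fintype n] (a : CStarMatrix l m A) (b : CStarMatrix m n A)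
    (c : CStarMatrix n o A) : a * b * c = a * (b * c) :=
  Matrix.mul_assoc (α := A) a b c

theorem conjTranspose_mul [Fintype m] (a : CStarMatrix l m A) (b : CStarMatrix m n A) :
    (a * b).conjTranspose = b.conjTranspose * a.conjTranspose :=
  Matrix.conjTranspose_mul (α := A) a b

theorem conjTranspose_conjTranspose (a : CStarMatrix l m A) :
    a.conjTranspose.conjTranspose = a :=
  Matrix.conjTranspose_conjTranspose (α := A) a

theorem one_mul [Fintype m] [DecidableEq m] (a : CStarMatrix m n A) :
    (1 : CStarMatrix m m A) * a = a :=
  Matrix.one_mul (α := A) a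

theorem mul_one [Fintype n] [DecidableEq n] (a : CStarMatrix m n A) :
    a * (1 : CStarMatrix n n A) = a :=
  Matrix.mul_one (α := A) a

theorem mul_sub [Fintype m] (a : CStarMatrix l m A) (b c : CStarMatrix m n A) :
    a * (b - c) = a * b - a * c :=
  Matrix.mul_sub (α := A) a b c

theorem sub_mul [Fintype m] (a b : CStarMatrix l m A) (c : CStarMatrix m n A) :
    (a - b) * c = a * c - b * c :=
  Matrix.sub_mul (α := A) a b c

theorem continuous_mul [Fintype m] :
    Continuous fun p : CStarMatrix l m A × CStarMatrix m n A => p.1 * p.2 :=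
  Continuous.matrix_mul (R := A) (A := fun p : Matrix l m A × Matrix m n A => p.1)
    (B := fun p => p.2) continuous_fst continuous_snd

theorem continuous_conj [Fintype m] (r : CStarMatrix l m A) :
    Continuous fun b : CStarMatrix m m A => r * b * r.conjTranspose :=
  continuous_mul.comp ((continuous_mul.comp (continuous_const.prodMk continuous_id)).prodMk
    continuous_const)

end Mat

/-- Cuntz subequivalence between square matrices of different sizes, via rectangular matrices. -/
def Below [Fintype n] (a : CStarMatrix m m A) (b : CStarMatrix n n A) : Prop :=
  a ∈ closure (Set.range fun r : CStarMatrix m n A => r * b * r.conjTranspose)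

namespace Below

variable [Fintype n] [Fintype o]

theorem of_eq {a : CStarMatrix m m A} {b : CStarMatrix n n A} (r : CStarMatrix m n A)
    (h : r * b * r.conjTranspose = a) : Below a b :=
  subset_closure ⟨r, h⟩

theorem trans {a : CStarMatrix m m A} {b : CStarMatrix n n A} {c : CStarMatrix o o A}
    (hab : Below a b) (hbc : Below b c) : Below a c := by
  refine closure_minimal ?_ isClosed_closure hab
  rintro _ ⟨r, rfl⟩
  refine map_mem_closure (f := fun b => r * b * r.conjTranspose) (Mat.continuous_conj r) hbc ?_
  rintro _ ⟨s, rfl⟩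
  exact ⟨r * s, by simp only [Mat.mul_assoc, Mat.conjTranspose_mul]⟩

variable [Fintype m]

theorem refl [DecidableEq m] (a : CStarMatrix m m A) : Below a a :=
  of_eq 1 (by
    have : (1 : CStarMatrix m m A).conjTranspose = 1 := star_one _
    rw [this, Mat.mul_one, Mat.one_mul])

omit [Fintype m] in
theorem zero_le (b : CStarMatrix n n A) : Below (0 : CStarMatrix m m A) b :=
  of_eq 0 (by rw [CStarMatrix.zero_mul, CStarMatrix.zero_mul])

theorem of_conj {a : CStarMatrix m m A} {b : CStarMatrix n n A} (r : CStarMatrix m n A)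
    (h : a ∈ closure (Set.range fun s : CStarMatrix m m A =>
      s * (r * b * r.conjTranspose) * star s)) : Below a b := by
  refine closure_mono ?_ h
  rintro _ ⟨s, rfl⟩
  refine ⟨s * r, ?_⟩
  simp only [Mat.mul_assoc, Mat.conjTranspose_mul]
  rfl

theorem exists_near [PartialOrder A] [StarOrderedRing A] {a : CStarMatrix m m A}
    {b : CStarMatrix n n A} (h : Below a b) {ε : ℝ} (hε : 0 < ε) :
    ∃ r : CStarMatrix m n A, ‖a - r * b * r.conjTranspose‖ < ε := by
  obtain ⟨r, hr⟩ := Metric.mem_closure_range_iff.1 h ε hε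
  exact ⟨r, by rwa [dist_eq_norm] at hr⟩

end Below

section Order

variable [PartialOrder A] [StarOrderedRing A]
variable [Fintype m] [Fintype n]

/-- Each row of `t`, placed as row `j₀` of an otherwise zero square matrix, contributes one term
`star R * R`; these terms sum to `t* t`. This reduces the rectangular case to the square one. -/
theorem Mat.conjTranspose_mul_self_nonneg (t : CStarMatrix n m A) : 0 ≤ t.conjTranspose * t := by
  rcases isEmpty_or_nonempty m with hm | ⟨⟨j₀⟩⟩
  · have : t.conjTranspose * t = 0 := CStarMatrix.ext fun i => isEmptyElim i
    rw [this]
  classical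
  have h : t.conjTranspose * t = ∑ i, star (CStarMatrix.ofMatrix
      (fun j k => if j = j₀ then t i k else 0) : CStarMatrix m m A) *
      CStarMatrix.ofMatrix (fun j k => if j = j₀ then t i k else 0) := by
    refine CStarMatrix.ext fun k l => ?_
    have hsum : ∀ f : n → CStarMatrix m m A, (∑ i, f i) k l = ∑ i, f i k l := fun f =>
      Matrix.sum_apply k l Finset.univ f
    rw [hsum, CStarMatrix.mul_apply]
    refine Finset.sum_congr rfl fun i _ => ?_
    rw [CStarMatrix.mul_apply, Finset.sum_eq_single j₀]
    · simp [CStarMatrix.star_apply, Mat.ofMatrix_apply]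
    · intro j _ hj
      simp [CStarMatrix.star_apply, Mat.ofMatrix_apply, hj]
    · simp
  rw [h]
  exact Finset.sum_nonneg fun i _ => star_mul_self_nonneg _

theorem Mat.conj_nonneg {b : CStarMatrix n n A} (hb : 0 ≤ b) (r : CStarMatrix m n A) :
    0 ≤ r * b * r.conjTranspose := by
  classical
  obtain ⟨s, rfl⟩ := exists_eq_star_mul_self hb
  have := Mat.conjTranspose_mul_self_nonneg (s * r.conjTranspose)
  rw [Mat.conjTranspose_mul, Mat.conjTranspose_conjTranspose] at this
  simp only [Mat.mul_assoc] at this ⊢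
  exact this

theorem Mat.conj_le_conj {b c : CStarMatrix n n A} (h : b ≤ c) (r : CStarMatrix m n A) :
    r * b * r.conjTranspose ≤ r * c * r.conjTranspose := by
  have := Mat.conj_nonneg (sub_nonneg.2 h) r
  rwa [Mat.mul_sub, Mat.sub_mul, sub_nonneg] at this

variable [DecidableEq m]

theorem Below.cutDown_of_le {a : CStarMatrix m m A} {b : CStarMatrix n n A}
    (ha : IsSelfAdjoint a) {δ : ℝ} (r : CStarMatrix m n A)
    (h : a ≤ r * b * r.conjTranspose + δ • (1 : CStarMatrix m m A)) :
    Below (cutDown a δ) b :=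
  Below.of_conj r (cutDown_mem_closure_conj ha h)

theorem Below.cutDown_of_le' {a b : CStarMatrix m m A} (ha : IsSelfAdjoint a) {δ : ℝ}
    (h : a ≤ b + δ • (1 : CStarMatrix m m A)) : Below (cutDown a δ) b :=
  cutDown_mem_closure_conj ha h

theorem Below.of_le {a b : CStarMatrix m m A} (ha : 0 ≤ a) (h : a ≤ b) : Below a b :=
  mem_closure_conj_of_le ha h

end Order

section Sums

variable {n m p q : ℕ}

/-- The coordinate matrix of an injection of index sets. -/
def incl [DecidableEq o] (f : l → o) : CStarMatrix l o A :=
  CStarMatrix.ofMatrix fun i j => if f i = j then 1 else 0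

theorem incl_apply [DecidableEq o] (f : l → o) (i : l) (j : o) :
    incl (A := A) f i j = if f i = j then 1 else 0 := rfl

theorem incl_mul_conjTranspose_incl [DecidableEq o] [DecidableEq l] [Fintype o] {f : l → o}
    (hf : Function.Injective f) : incl (A := A) f * (incl (A := A) f).conjTranspose = 1 := by
  refine CStarMatrix.ext fun i j => ?_
  simp [CStarMatrix.mul_apply, incl_apply, CStarMatrix.conjTranspose_apply, CStarMatrix.one_apply,
    hf.eq_iff, eq_comm, apply_ite star]

theorem incl_mul_conjTranspose_incl_eq_zero {l' : Type*} [DecidableEq o] [Fintype o] {f : l → o}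
    {g : l' → o} (hfg : ∀ i j, f i ≠ g j) : incl (A := A) f * (incl (A := A) g).conjTranspose = 0 := by
  refine CStarMatrix.ext fun i j => ?_
  simp [CStarMatrix.mul_apply, incl_apply, CStarMatrix.conjTranspose_apply, (hfg i j).symm]

variable (A n m) in
/-- The first coordinate block. -/
def fstBlock : CStarMatrix (Fin n) (Fin (n + m)) A := incl (Fin.castAdd m)

variable (A n m) in
/-- The second coordinate block. -/
def sndBlock : CStarMatrix (Fin m) (Fin (n + m)) A := incl (Fin.natAdd n)

@[simp] theorem fstBlock_mul_fstBlock :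
    fstBlock A n m * (fstBlock A n m).conjTranspose = 1 :=
  incl_mul_conjTranspose_incl (Fin.castAdd_injective n m)

@[simp] theorem sndBlock_mul_sndBlock :
    sndBlock A n m * (sndBlock A n m).conjTranspose = 1 :=
  incl_mul_conjTranspose_incl (Fin.natAdd_injective m n)

@[simp] theorem fstBlock_mul_sndBlock :
    fstBlock A n m * (sndBlock A n m).conjTranspose = 0 :=
  incl_mul_conjTranspose_incl_eq_zero fun i j h => by
    have := congrArg Fin.val h
    simp at this
    omega

@[simp] theorem sndBlock_mul_fstBlock :
    sndBlock A n m * (fstBlock A n m).conjTranspose = 0 :=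
  incl_mul_conjTranspose_incl_eq_zero fun i j h => by
    have := congrArg Fin.val h
    simp at this
    omega

@[simp] theorem fstBlock_mul_fstBlock_mul (x : CStarMatrix (Fin n) o A) :
    fstBlock A n m * ((fstBlock A n m).conjTranspose * x) = x := by
  rw [← Mat.mul_assoc, fstBlock_mul_fstBlock, Mat.one_mul]

@[simp] theorem sndBlock_mul_sndBlock_mul (x : CStarMatrix (Fin m) o A) :
    sndBlock A n m * ((sndBlock A n m).conjTranspose * x) = x := by
  rw [← Mat.mul_assoc, sndBlock_mul_sndBlock, Mat.one_mul]

@[simp] theorem fstBlock_mul_sndBlock_mul (x : CStarMatrix (Fin m) o A) :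
    fstBlock A n m * ((sndBlock A n m).conjTranspose * x) = 0 := by
  rw [← Mat.mul_assoc, fstBlock_mul_sndBlock, CStarMatrix.zero_mul]

@[simp] theorem sndBlock_mul_fstBlock_mul (x : CStarMatrix (Fin n) o A) :
    sndBlock A n m * ((fstBlock A n m).conjTranspose * x) = 0 := by
  rw [← Mat.mul_assoc, sndBlock_mul_fstBlock, CStarMatrix.zero_mul]

theorem directSum_apply (a : CStarMatrix (Fin n) (Fin n) A) (b : CStarMatrix (Fin m) (Fin m) A)
    (i j : Fin (n + m)) : directSum a b i j =
      Matrix.fromBlocks (CStarMatrix.ofMatrix.symm a) 0 0 (CStarMatrix.ofMatrix.symm b)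
        (finSumFinEquiv.symm i) (finSumFinEquiv.symm j) := rfl

/-- With this form, identities about direct sums follow from the isometry relations between the two
blocks, without computing entries. -/
theorem directSum_eq (a : CStarMatrix (Fin n) (Fin n) A) (b : CStarMatrix (Fin m) (Fin m) A) :
    directSum a b = (fstBlock A n m).conjTranspose * (a * fstBlock A n m) +
      (sndBlock A n m).conjTranspose * (b * sndBlock A n m) := by
  refine CStarMatrix.ext fun i j => ?_
  rw [directSum_apply]
  have h1 : ∀ (i : Fin n) (j : Fin m), Fin.castAdd m i ≠ Fin.natAdd n j := fun i j h => by
    have := congrArg Fin.val h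
    simp at this
    omega
  have h2 : ∀ (i : Fin n) (j : Fin m), Fin.natAdd n j ≠ Fin.castAdd m i :=
    fun i j h => h1 i j h.symm
  refine Fin.addCases (fun i => ?_) (fun i => ?_) i <;>
    refine Fin.addCases (fun j => ?_) (fun j => ?_) j <;>
    simp [CStarMatrix.mul_apply, incl_apply, CStarMatrix.conjTranspose_apply, fstBlock, sndBlock,
      h1, h2, apply_ite star, Fin.natAdd_inj]

theorem blocks_add : (fstBlock A n m).conjTranspose * fstBlock A n m +
    (sndBlock A n m).conjTranspose * sndBlock A n m = 1 := by
  have h := directSum_eq (1 : CStarMatrix (Fin n) (Fin n) A) (1 : CStarMatrix (Fin m) (Fin m) A)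
  rw [Mat.one_mul, Mat.one_mul] at h
  rw [← h]
  have h1 : CStarMatrix.ofMatrix.symm (1 : CStarMatrix (Fin n) (Fin n) A) = (1 : Matrix _ _ A) :=
    rfl
  have h2 : CStarMatrix.ofMatrix.symm (1 : CStarMatrix (Fin m) (Fin m) A) = (1 : Matrix _ _ A) :=
    rfl
  rw [directSum, h1, h2, Matrix.fromBlocks_one]
  simp
  rfl

end Sums

end Rectangular

/-! ### Direct sums, copies and padding under Cuntz comparison -/

section DirectSum

variable {A : Type*} [CStarAlgebra A] {n m p q : ℕ}

theorem directSum_sub (a c : CStarMatrix (Fin n) (Fin n) A) (b d : CStarMatrix (Fin m) (Fin m) A) :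
    directSum (a - c) (b - d) = directSum a b - directSum c d := by
  simp only [directSum_eq, Mat.sub_mul, Mat.mul_sub]
  abel

theorem directSum_smul (t : ℝ) (a : CStarMatrix (Fin n) (Fin n) A)
    (b : CStarMatrix (Fin m) (Fin m) A) :
    directSum (t • a) (t • b) = t • directSum a b := by
  simp only [directSum_eq, CStarMatrix.smul_mul, CStarMatrix.mul_smul, smul_add]

theorem directSum_one : directSum (1 : CStarMatrix (Fin n) (Fin n) A)
    (1 : CStarMatrix (Fin m) (Fin m) A) = 1 := by
  simp only [directSum_eq, Mat.one_mul, blocks_add]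

theorem directSum_zero : directSum (0 : CStarMatrix (Fin n) (Fin n) A)
    (0 : CStarMatrix (Fin m) (Fin m) A) = 0 := by
  simp only [directSum_eq, CStarMatrix.zero_mul, CStarMatrix.mul_zero, add_zero]

theorem directSum_mul (a c : CStarMatrix (Fin n) (Fin n) A)
    (b d : CStarMatrix (Fin m) (Fin m) A) :
    directSum a b * directSum c d = directSum (a * c) (b * d) := by
  simp only [directSum_eq, CStarMatrix.mul_add, CStarMatrix.add_mul, Mat.mul_assoc,
    fstBlock_mul_fstBlock_mul, fstBlock_mul_sndBlock_mul, sndBlock_mul_fstBlock_mul,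
    sndBlock_mul_sndBlock_mul, CStarMatrix.mul_zero, add_zero, zero_add]

theorem directSum_star (a : CStarMatrix (Fin n) (Fin n) A) (b : CStarMatrix (Fin m) (Fin m) A) :
    star (directSum a b) = directSum (star a) (star b) := by
  simp only [directSum_eq, star_add, CStarMatrix.star_eq_conjTranspose, Mat.conjTranspose_mul,
    Mat.conjTranspose_conjTranspose, Mat.mul_assoc]

theorem directSum_isSelfAdjoint {a : CStarMatrix (Fin n) (Fin n) A}
    {b : CStarMatrix (Fin m) (Fin m) A} (ha : IsSelfAdjoint a) (hb : IsSelfAdjoint b) :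
    IsSelfAdjoint (directSum a b) := by
  rw [IsSelfAdjoint, directSum_star, ha.star_eq, hb.star_eq]

theorem conj_directSum (a : CStarMatrix (Fin n) (Fin n) A) (b : CStarMatrix (Fin m) (Fin m) A)
    {o : Type*} (r : CStarMatrix o (Fin n) A) (s : CStarMatrix o (Fin m) A) :
    (r * fstBlock A n m + s * sndBlock A n m) * directSum a b *
      (r * fstBlock A n m + s * sndBlock A n m).conjTranspose =
      r * a * r.conjTranspose + s * b * s.conjTranspose := by
  have hadd : ∀ x y : CStarMatrix o (Fin (n + m)) A,
      (x + y).conjTranspose = x.conjTranspose + y.conjTranspose :=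
    Matrix.conjTranspose_add (α := A)
  simp only [directSum_eq, hadd, Mat.conjTranspose_mul, CStarMatrix.mul_add, CStarMatrix.add_mul,
    Mat.mul_assoc,
    fstBlock_mul_fstBlock_mul, fstBlock_mul_sndBlock_mul, sndBlock_mul_fstBlock_mul,
    sndBlock_mul_sndBlock_mul, CStarMatrix.mul_zero, add_zero, zero_add]

namespace Below

/-- Stacking `r` above `s` compresses `c` to a 2×2 block matrix whose off-diagonal blocks vanish by
assumption. -/
theorem directSum_le_of_conj {o : Type*} [Fintype o] {a : CStarMatrix (Fin n) (Fin n) A}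
    {b : CStarMatrix (Fin m) (Fin m) A} {c : CStarMatrix o o A} (r : CStarMatrix (Fin n) o A)
    (s : CStarMatrix (Fin m) o A) (hr : r * c * r.conjTranspose = a)
    (hs : s * c * s.conjTranspose = b) (hrs : r * c * s.conjTranspose = 0)
    (hsr : s * c * r.conjTranspose = 0) : Below (directSum a b) c := by
  have hadd : ∀ x y : CStarMatrix (Fin (n + m)) o A,
      (x + y).conjTranspose = x.conjTranspose + y.conjTranspose :=
    Matrix.conjTranspose_add (α := A)
  refine of_eq ((fstBlock A n m).conjTranspose * r + (sndBlock A n m).conjTranspose * s) ?_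
  rw [directSum_eq, ← hr, ← hs]
  simp only [hadd, Mat.conjTranspose_mul, Mat.conjTranspose_conjTranspose, CStarMatrix.mul_add,
    CStarMatrix.add_mul]
  have h1 : (fstBlock A n m).conjTranspose * r * c * (s.conjTranspose * sndBlock A n m) =
      (fstBlock A n m).conjTranspose * (r * c * s.conjTranspose) * sndBlock A n m := by
    simp only [Mat.mul_assoc]
  have h2 : (sndBlock A n m).conjTranspose * s * c * (r.conjTranspose * fstBlock A n m) =
      (sndBlock A n m).conjTranspose * (s * c * r.conjTranspose) * fstBlock A n m := by
    simp only [Mat.mul_assoc]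
  rw [h1, h2, hrs, hsr]
  simp only [CStarMatrix.mul_zero, CStarMatrix.zero_mul, add_zero, zero_add, Mat.mul_assoc]

theorem directSum {a : CStarMatrix (Fin n) (Fin n) A} {b : CStarMatrix (Fin m) (Fin m) A}
    {c : CStarMatrix (Fin p) (Fin p) A} {d : CStarMatrix (Fin q) (Fin q) A}
    (hac : Below a c) (hbd : Below b d) : Below (directSum a b) (directSum c d) := by
  have hcont : Continuous fun x : CStarMatrix (Fin n) (Fin n) A × CStarMatrix (Fin m) (Fin m) A =>
      AsympTracial.directSum x.1 x.2 := by
    simp only [directSum_eq]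
    refine Continuous.add ?_ ?_
    · exact Mat.continuous_mul.comp (continuous_const.prodMk
        (Mat.continuous_mul.comp (continuous_fst.prodMk continuous_const)))
    · exact Mat.continuous_mul.comp (continuous_const.prodMk
        (Mat.continuous_mul.comp (continuous_snd.prodMk continuous_const)))
  refine map_mem_closure₂ (f := fun x y => AsympTracial.directSum x y) hcont hac hbd ?_
  rintro _ ⟨r, rfl⟩ _ ⟨s, rfl⟩
  refine ⟨(fstBlock A n m).conjTranspose * (r * fstBlock A p q) +
    (sndBlock A n m).conjTranspose * (s * sndBlock A p q), ?_⟩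
  have hadd : ∀ x y : CStarMatrix (Fin (n + m)) (Fin (p + q)) A,
      (x + y).conjTranspose = x.conjTranspose + y.conjTranspose :=
    Matrix.conjTranspose_add (α := A)
  simp only [directSum_eq, hadd, Mat.conjTranspose_mul, Mat.conjTranspose_conjTranspose,
    CStarMatrix.mul_add, CStarMatrix.add_mul, Mat.mul_assoc,
    fstBlock_mul_fstBlock_mul, fstBlock_mul_sndBlock_mul, sndBlock_mul_fstBlock_mul,
    sndBlock_mul_sndBlock_mul, CStarMatrix.mul_zero, add_zero, zero_add]

variable (a : CStarMatrix (Fin n) (Fin n) A) (b : CStarMatrix (Fin m) (Fin m) A)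
  (c : CStarMatrix (Fin p) (Fin p) A)

theorem le_directSum_left : Below a (AsympTracial.directSum a b) := by
  refine of_eq (fstBlock A n m) ?_
  simp [directSum_eq, CStarMatrix.mul_add, Mat.mul_assoc]

theorem directSum_comm : Below (AsympTracial.directSum a b) (AsympTracial.directSum b a) := by
  refine directSum_le_of_conj (sndBlock A m n) (fstBlock A m n) ?_ ?_ ?_ ?_ <;>
  simp [directSum_eq, CStarMatrix.mul_add, Mat.mul_assoc, CStarMatrix.mul_zero]

theorem directSum_assoc :
    Below (AsympTracial.directSum (AsympTracial.directSum a b) c)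
      (AsympTracial.directSum a (AsympTracial.directSum b c)) := by
  have hadd : ∀ x y : CStarMatrix (Fin (n + m)) (Fin (n + (m + p))) A,
      (x + y).conjTranspose = x.conjTranspose + y.conjTranspose :=
    Matrix.conjTranspose_add (α := A)
  refine directSum_le_of_conj ((fstBlock A n m).conjTranspose * fstBlock A n (m + p) +
    (sndBlock A n m).conjTranspose * (fstBlock A m p * sndBlock A n (m + p)))
    (sndBlock A m p * sndBlock A n (m + p)) ?_ ?_ ?_ ?_ <;>
  simp [directSum_eq, CStarMatrix.mul_add, CStarMatrix.add_mul, Mat.mul_assoc, hadd,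
    CStarMatrix.mul_zero, Mat.conjTranspose_mul, Mat.conjTranspose_conjTranspose]

theorem directSum_assoc' :
    Below (AsympTracial.directSum a (AsympTracial.directSum b c))
      (AsympTracial.directSum (AsympTracial.directSum a b) c) := by
  have hadd : ∀ x y : CStarMatrix (Fin (m + p)) (Fin (n + m + p)) A,
      (x + y).conjTranspose = x.conjTranspose + y.conjTranspose :=
    Matrix.conjTranspose_add (α := A)
  refine directSum_le_of_conj (fstBlock A n m * fstBlock A (n + m) p)
    ((fstBlock A m p).conjTranspose * (sndBlock A n m * fstBlock A (n + m) p) +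
      (sndBlock A m p).conjTranspose * sndBlock A (n + m) p) ?_ ?_ ?_ ?_ <;>
  simp [directSum_eq, CStarMatrix.mul_add, CStarMatrix.add_mul, Mat.mul_assoc, hadd,
    CStarMatrix.mul_zero, Mat.conjTranspose_mul, Mat.conjTranspose_conjTranspose]

theorem directSum_zero_le (z : CStarMatrix (Fin m) (Fin m) A) (hz : z = 0) :
    Below (AsympTracial.directSum a z) a := by
  subst hz
  refine directSum_le_of_conj 1 0 ?_ ?_ ?_ ?_
  · have : (1 : CStarMatrix (Fin n) (Fin n) A).conjTranspose = 1 := star_one _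
    rw [this, Mat.mul_one, Mat.one_mul]
  · rw [CStarMatrix.zero_mul, CStarMatrix.zero_mul]
  · have : (0 : CStarMatrix (Fin m) (Fin n) A).conjTranspose = 0 := CStarMatrix.conjTranspose_zero
    rw [this, CStarMatrix.mul_zero]
  · rw [CStarMatrix.zero_mul, CStarMatrix.zero_mul]

end Below

section Order

variable [PartialOrder A] [StarOrderedRing A]

theorem directSum_nonneg {a : CStarMatrix (Fin n) (Fin n) A} {b : CStarMatrix (Fin m) (Fin m) A}
    (ha : 0 ≤ a) (hb : 0 ≤ b) : 0 ≤ directSum a b := by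
  have h1 := Mat.conj_nonneg ha (fstBlock A n m).conjTranspose
  have h2 := Mat.conj_nonneg hb (sndBlock A n m).conjTranspose
  rw [Mat.conjTranspose_conjTranspose, Mat.mul_assoc] at h1 h2
  rw [directSum_eq]
  exact add_nonneg h1 h2

theorem cutDown_directSum {a : CStarMatrix (Fin n) (Fin n) A}
    {b : CStarMatrix (Fin m) (Fin m) A} (ha : IsSelfAdjoint a) (hb : IsSelfAdjoint b) (δ : ℝ) :
    cutDown (directSum a b) δ = directSum (cutDown a δ) (cutDown b δ) := by
  obtain ⟨q, hq, h1, h2⟩ := exists_sub_eq_cutDown_sub ha δ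
  obtain ⟨q', hq', h1', h2'⟩ := exists_sub_eq_cutDown_sub hb δ
  refine cutDown_eq_of_sub_eq (directSum_isSelfAdjoint ha hb)
    (directSum_nonneg (cutDown_nonneg a δ) (cutDown_nonneg b δ)) (directSum_nonneg hq hq') ?_ ?_
  · rw [← directSum_sub, ← h1, ← h1', directSum_sub, ← directSum_one]
    exact congrArg _ (directSum_smul δ _ _).symm
  · rw [directSum_mul, h2, h2', directSum_zero]

theorem copies_nonneg {b : CStarMatrix (Fin n) (Fin n) A} (hb : 0 ≤ b) (k : ℕ) :
    0 ≤ copies b k := by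
  induction k with
  | zero => exact le_rfl
  | succ k ih => exact directSum_nonneg ih hb

theorem cutDown_copies {b : CStarMatrix (Fin n) (Fin n) A} (hb : 0 ≤ b) (δ : ℝ) (k : ℕ) :
    cutDown (copies b k) δ = copies (cutDown b δ) k := by
  induction k with
  | zero => exact CStarMatrix.ext fun i => i.elim0
  | succ k ih =>
    rw [copies, cutDown_directSum (.of_nonneg (copies_nonneg hb k)) (.of_nonneg hb), ih]
    rfl

end Order

theorem pad_eq {N : ℕ} (h : n ≤ N) (a : CStarMatrix (Fin n) (Fin n) A) :
    pad N a = (incl (Fin.castLE h)).conjTranspose * (a * incl (Fin.castLE h)) := by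
  refine CStarMatrix.ext fun i j => ?_
  have h0 : pad N a i j = if h : (i : ℕ) < n ∧ (j : ℕ) < n then a ⟨i, h.1⟩ ⟨j, h.2⟩ else 0 := rfl
  rw [h0]
  have key : ∀ (i : Fin n) (j : Fin N), Fin.castLE h i = j ↔ (i : ℕ) = j := fun i j => by
    rw [Fin.ext_iff]; rfl
  simp only [CStarMatrix.mul_apply, CStarMatrix.conjTranspose_apply, incl_apply, key]
  split_ifs with hij
  · rw [Finset.sum_eq_single ⟨i, hij.1⟩, Finset.sum_eq_single ⟨j, hij.2⟩]
    · simp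
    · intro b _ hb
      rw [if_neg (fun h' => hb (Fin.ext h')), mul_zero]
    · simp
    · intro b _ hb
      rw [if_neg (fun h' => hb (Fin.ext h')), star_zero, zero_mul]
    · simp
  · symm
    refine Finset.sum_eq_zero fun x _ => ?_
    by_cases hi : (i : ℕ) < n
    · have hj : ¬ (j : ℕ) < n := fun hj => hij ⟨hi, hj⟩
      have : ∀ y : Fin n, (y : ℕ) ≠ j := fun y hy => hj (hy ▸ y.2)
      simp [this]
    · have : (x : ℕ) ≠ i := fun hx => hi (hx ▸ x.2)
      simp [this]

theorem Below.pad_le {N : ℕ} (h : n ≤ N) (a : CStarMatrix (Fin n) (Fin n) A) :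
    Below (pad N a) a :=
  .of_eq (incl (Fin.castLE h)).conjTranspose (by
    rw [pad_eq h, Mat.conjTranspose_conjTranspose, Mat.mul_assoc])

theorem Below.le_pad {N : ℕ} (h : n ≤ N) (a : CStarMatrix (Fin n) (Fin n) A) :
    Below a (pad N a) := by
  have h1 := incl_mul_conjTranspose_incl (A := A) (Fin.castLE_injective h)
  refine .of_eq (incl (Fin.castLE h)) ?_
  rw [pad_eq h, ← Mat.mul_assoc, h1, Mat.one_mul, Mat.mul_assoc, h1, Mat.mul_one]

variable [PartialOrder A] [StarOrderedRing A]

/-- Every matrix is equivalent to its padding through a rectangular coordinate matrix, so the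
padding can be dropped. -/
theorem matCuntzLE_iff_below {a : CStarMatrix (Fin n) (Fin n) A}
    {b : CStarMatrix (Fin m) (Fin m) A} : MatCuntzLE a b ↔ Below a b := by
  have h : MatCuntzLE a b ↔ Below (pad (max n m) a) (pad (max n m) b) :=
    cuntzLE_iff_mem_closure
  rw [h]
  constructor
  · intro h
    exact ((Below.le_pad (le_max_left n m) a).trans h).trans (.pad_le (le_max_right n m) b)
  · intro h
    exact ((Below.pad_le (le_max_left n m) a).trans h).trans (.le_pad (le_max_right n m) b)

end DirectSum

/-! ### The ordered monoid of Cuntz classes -/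

section CuntzSemigroup

variable (A : Type*) [CStarAlgebra A]

/-- Square matrices of arbitrary size. -/
def MatInfty : Type _ := Σ n : ℕ, CStarMatrix (Fin n) (Fin n) A

instance : Preorder (MatInfty A) where
  le a b := Below a.2 b.2
  le_refl a := Below.refl a.2
  le_trans _ _ _ := Below.trans

/-- The ordered monoid of Cuntz classes of matrices. -/
def CuntzClass : Type _ := Antisymmetrization (MatInfty A) (· ≤ ·)

noncomputable instance : PartialOrder (CuntzClass A) :=
  inferInstanceAs (PartialOrder (Antisymmetrization (MatInfty A) (· ≤ ·)))

variable {A}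

/-- The Cuntz class of a matrix. -/
def cls {n : ℕ} (a : CStarMatrix (Fin n) (Fin n) A) : CuntzClass A :=
  toAntisymmetrization (· ≤ ·) (⟨n, a⟩ : MatInfty A)

theorem cls_le_cls {n m : ℕ} {a : CStarMatrix (Fin n) (Fin n) A}
    {b : CStarMatrix (Fin m) (Fin m) A} : cls a ≤ cls b ↔ Below a b := Iff.rfl

theorem CuntzClass.ind {P : CuntzClass A → Prop}
    (h : ∀ (n : ℕ) (a : CStarMatrix (Fin n) (Fin n) A), P (cls a)) (x : CuntzClass A) : P x :=
  Quotient.inductionOn' x fun a => h a.1 a.2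

instance : Add (CuntzClass A) where
  add := Quotient.map₂ (fun a b : MatInfty A => (⟨a.1 + b.1, directSum a.2 b.2⟩ : MatInfty A))
    fun _ _ h _ _ h' => ⟨Below.directSum h.1 h'.1, Below.directSum h.2 h'.2⟩

instance : Zero (CuntzClass A) where
  zero := cls (0 : CStarMatrix (Fin 0) (Fin 0) A)

theorem cls_add_cls {n m : ℕ} (a : CStarMatrix (Fin n) (Fin n) A)
    (b : CStarMatrix (Fin m) (Fin m) A) : cls a + cls b = cls (directSum a b) := rfl

theorem CuntzClass.zero_le (x : CuntzClass A) : 0 ≤ x :=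
  CuntzClass.ind (fun _ a => Below.zero_le a) x

theorem cls_zero {n : ℕ} : cls (0 : CStarMatrix (Fin n) (Fin n) A) = 0 :=
  le_antisymm (Below.zero_le _) (CuntzClass.zero_le _)

protected theorem CuntzClass.add_comm (x y : CuntzClass A) : x + y = y + x := by
  induction x using CuntzClass.ind with | _ n a
  induction y using CuntzClass.ind with | _ m b
  exact le_antisymm (Below.directSum_comm a b) (Below.directSum_comm b a)

protected theorem CuntzClass.add_zero (x : CuntzClass A) : x + 0 = x := by
  induction x using CuntzClass.ind with | _ n a
  exact le_antisymm (Below.directSum_zero_le a 0 rfl) (Below.le_directSum_left a 0)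

instance : AddCommMonoid (CuntzClass A) where
  add_assoc x y z := by
    induction x using CuntzClass.ind with | _ n a
    induction y using CuntzClass.ind with | _ m b
    induction z using CuntzClass.ind with | _ p c
    exact le_antisymm (Below.directSum_assoc a b c) (Below.directSum_assoc' a b c)
  add_comm := CuntzClass.add_comm
  add_zero := CuntzClass.add_zero
  zero_add x := by rw [CuntzClass.add_comm, CuntzClass.add_zero]
  nsmul := nsmulRec

instance : IsOrderedAddMonoid (CuntzClass A) where
  add_le_add_left x y h z := by
    induction x using CuntzClass.ind with | _ n a
    induction y using CuntzClass.ind with | _ m b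
    induction z using CuntzClass.ind with | _ p c
    exact Below.directSum h (Below.refl c)

theorem cls_copies {n : ℕ} (b : CStarMatrix (Fin n) (Fin n) A) (k : ℕ) :
    cls (copies b k) = k • cls b := by
  induction k with
  | zero => rw [zero_nsmul]; exact cls_zero
  | succ k ih => rw [succ_nsmul, ← ih, cls_add_cls]; rfl

/-- The row `(1, 1)` conjugates `a ⊕ b` to `a + b`. -/
theorem cls_add_le {n : ℕ} (a b : CStarMatrix (Fin n) (Fin n) A) :
    cls (a + b) ≤ cls a + cls b := by
  have h1 : (1 : CStarMatrix (Fin n) (Fin n) A).conjTranspose = 1 := star_one _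
  have h := conj_directSum a b (1 : CStarMatrix (Fin n) (Fin n) A) 1
  refine Below.of_eq _ (h.trans ?_)
  rw [h1]
  simp only [Mat.mul_one, Mat.one_mul]

theorem cls_sum_le {n : ℕ} {ι : Type*} (s : Finset ι) (f : ι → CStarMatrix (Fin n) (Fin n) A) :
    cls (∑ i ∈ s, f i) ≤ ∑ i ∈ s, cls (f i) := by
  classical
  induction s using Finset.induction_on with
  | empty => exact cls_zero.le
  | insert i s hi ih =>
    rw [Finset.sum_insert hi, Finset.sum_insert hi]
    exact (cls_add_le _ _).trans (by gcongr)

end CuntzSemigroup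

/-! ### Adding classes of almost orthogonal elements -/

section Orthogonal

variable {A : Type*} [CStarAlgebra A] [PartialOrder A] [StarOrderedRing A] {n m : ℕ}

theorem Below.cutDown_sub {a : CStarMatrix (Fin n) (Fin n) A} (ha : IsSelfAdjoint a) (δ : ℝ) :
    Below (cutDown a δ) (a - δ • (1 : CStarMatrix (Fin n) (Fin n) A)) :=
  cutDown_mem_closure_conj_sub ha δ

theorem Below.smul_le {t : ℝ} (ht : 0 ≤ t) (a : CStarMatrix (Fin n) (Fin n) A) :
    Below (t • a) a := by
  refine .of_eq (Real.sqrt t • (1 : CStarMatrix (Fin n) (Fin n) A)) ?_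
  have h : (Real.sqrt t • (1 : CStarMatrix (Fin n) (Fin n) A)).conjTranspose =
      Real.sqrt t • (1 : CStarMatrix (Fin n) (Fin n) A) :=
    (isSelfAdjoint_smul_one (C := CStarMatrix (Fin n) (Fin n) A) (Real.sqrt t)).star_eq
  rw [h, CStarMatrix.smul_mul, Mat.one_mul, CStarMatrix.mul_smul, Mat.mul_one, smul_smul,
    Real.mul_self_sqrt ht]

theorem directSum_mono {a c : CStarMatrix (Fin n) (Fin n) A} {b d : CStarMatrix (Fin m) (Fin m) A}
    (h : a ≤ c) (h' : b ≤ d) : directSum a b ≤ directSum c d := by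
  rw [← sub_nonneg, ← directSum_sub]
  exact directSum_nonneg (sub_nonneg.2 h) (sub_nonneg.2 h')

/-- Expansion of `(w - t)² ≥ 0`. -/
theorem smul_sub_le_mul_self {C : Type*} [CStarAlgebra C] [PartialOrder C] [StarOrderedRing C]
    {w : C} (hw : IsSelfAdjoint w) (t : ℝ) : t • w + t • w ≤ w * w + (t * t) • (1 : C) := by
  have h := (hw.sub (isSelfAdjoint_smul_one t)).mul_self_nonneg
  have e : (w - t • (1 : C)) * (w - t • (1 : C)) = w * w + (t * t) • (1 : C) - (t • w + t • w) := by
    simp only [mul_sub, sub_mul, mul_smul_comm, smul_mul_assoc, mul_one, one_mul, smul_smul,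
      smul_sub]
    abel
  rw [e] at h
  exact sub_nonneg.1 h

/-- Almost orthogonal positive elements whose sum is below `a` have orthogonal copies below `a`. -/
theorem cls_cutDown_add_cls_cutDown_le {a x y : CStarMatrix (Fin n) (Fin n) A} (hx : 0 ≤ x)
    (hy : 0 ≤ y) {τ κ : ℝ} (hτ : 0 < τ) (hκ : 0 ≤ κ)
    (hsum : x + y ≤ a + τ • (1 : CStarMatrix (Fin n) (Fin n) A))
    {s t : CStarMatrix (Fin n) (Fin n) A} (hssa : IsSelfAdjoint s) (htsa : IsSelfAdjoint t)
    (hss : s * s = x) (htt : t * t = y) (horth : ‖s * t‖ ≤ κ) :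
    cls (cutDown x (τ + κ)) + cls (cutDown y (τ + κ)) ≤ cls a := by
  have hs : s.conjTranspose = s := hssa.star_eq
  have ht : t.conjTranspose = t := htsa.star_eq
  set v := s * fstBlock A n n + t * sndBlock A n n with hv
  have hvv : v * v.conjTranspose = x + y := by
    have h := conj_directSum 1 1 s t
    rw [directSum_one, Mat.mul_one, Mat.mul_one, Mat.mul_one, hs, ht] at h
    rw [h, ← hss, ← htt]
  have hadd : v.conjTranspose = (fstBlock A n n).conjTranspose * s +
      (sndBlock A n n).conjTranspose * t := by
    have h : v.conjTranspose = (s * fstBlock A n n).conjTranspose +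
        (t * sndBlock A n n).conjTranspose := Matrix.conjTranspose_add (α := A) _ _
    rw [h, Mat.conjTranspose_mul, Mat.conjTranspose_mul, hs, ht]
  set w := v.conjTranspose * v with hw
  have hwsa : IsSelfAdjoint w := .of_nonneg (Mat.conjTranspose_mul_self_nonneg v)
  have h1 : w * w ≤ v.conjTranspose * a * v + τ • w := by
    have h := Mat.conj_le_conj hsum v.conjTranspose
    rw [Mat.conjTranspose_conjTranspose, CStarMatrix.mul_add v.conjTranspose a,
      CStarMatrix.add_mul _ _ v, CStarMatrix.mul_smul, CStarMatrix.smul_mul, Mat.mul_one,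
      ← hvv] at h
    refine le_trans (le_of_eq ?_) h
    change v.conjTranspose * v * (v.conjTranspose * v) = _
    simp only [Mat.mul_assoc]
  -- Of the two copies of `τ w` supplied by `(w - τ)² ≥ 0`, one absorbs the error `τ w` coming from
  -- `x + y ≤ a + τ`.
  have h2 : τ • w ≤ v.conjTranspose * a * v + (τ * τ) • (1 : CStarMatrix _ _ A) := by
    have h := (smul_sub_le_mul_self hwsa τ).trans (add_le_add h1 le_rfl)
    have h' : τ • w + τ • w ≤
        τ • w + (v.conjTranspose * a * v + (τ * τ) • (1 : CStarMatrix _ _ A)) :=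
      h.trans (le_of_eq (by abel))
    exact le_of_add_le_add_left h'
  have h3 : w ≤ v.conjTranspose * (τ⁻¹ • a) * v + τ • (1 : CStarMatrix _ _ A) := by
    have h := smul_le_smul_of_nonneg_left h2 (inv_nonneg.2 hτ.le)
    rw [smul_smul, inv_mul_cancel₀ hτ.ne', one_smul, smul_add, smul_smul,
      inv_mul_cancel_left₀ hτ.ne'] at h
    rwa [CStarMatrix.mul_smul, CStarMatrix.smul_mul]
  -- The off-diagonal part of `w = v* v`. Its square is block diagonal with corners `(s t)(s t)*`
  -- and `(t s)(t s)*`, so `‖z‖ ≤ κ`.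
  set z := (fstBlock A n n).conjTranspose * (s * t * sndBlock A n n) +
    (sndBlock A n n).conjTranspose * (t * s * fstBlock A n n) with hz
  have hwz : directSum x y = w - z := by
    rw [hw, hz, hadd, hv, directSum_eq, ← hss, ← htt]
    simp only [CStarMatrix.mul_add, CStarMatrix.add_mul, Mat.mul_assoc]
    have e1 : ∀ u v : CStarMatrix (Fin n) (Fin n) A, ∀ r : CStarMatrix (Fin n) (Fin (n + n)) A,
      (u * v) * r = u * (v * r) := Mat.mul_assoc
    abel
  have hzsa : IsSelfAdjoint z := by
    have : z = w - directSum x y := by rw [hwz]; abel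
    rw [this]
    exact hwsa.sub (.of_nonneg (directSum_nonneg hx hy))
  have hzz : star z * z = directSum (s * y * s) (t * x * t) := by
    rw [hzsa.star_eq]
    have e1 : ∀ u v : CStarMatrix (Fin n) (Fin n) A, ∀ r : CStarMatrix (Fin n) (Fin (n + n)) A,
      (u * v) * r = u * (v * r) := Mat.mul_assoc
    rw [hz, directSum_eq, ← hss, ← htt]
    simp only [CStarMatrix.mul_add, CStarMatrix.add_mul, Mat.mul_assoc, e1,
      fstBlock_mul_fstBlock_mul, fstBlock_mul_sndBlock_mul, sndBlock_mul_fstBlock_mul,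
      sndBlock_mul_sndBlock_mul, CStarMatrix.mul_zero, add_zero, zero_add]
    abel
  have hbound : ∀ {p q : CStarMatrix (Fin n) (Fin n) A}, IsSelfAdjoint p → IsSelfAdjoint q →
      ‖p * q‖ ≤ κ → p * (q * q) * p ≤ (κ ^ 2) • (1 : CStarMatrix (Fin n) (Fin n) A) := by
    intro p q hp hq hpq
    have h0 : p * (q * q) * p = (p * q) * star (p * q) := by
      rw [star_mul, hp.star_eq, hq.star_eq]
      noncomm_ring
    rw [h0]
    refine le_smul_one_of_norm_le (IsSelfAdjoint.mul_star_self _) ?_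
    rw [CStarRing.norm_self_mul_star, sq]
    gcongr
  have hznorm : ‖z‖ ≤ κ := by
    have h6 : star z * z ≤ (κ ^ 2) • (1 : CStarMatrix (Fin (n + n)) (Fin (n + n)) A) := by
      rw [hzz, ← directSum_one, ← directSum_smul]
      refine directSum_mono ?_ ?_
      · rw [← htt]
        exact hbound hssa htsa horth
      · rw [← hss]
        refine hbound htsa hssa ?_
        rwa [← norm_star, star_mul, hssa.star_eq, htsa.star_eq]
    have h7 : ‖z‖ * ‖z‖ ≤ κ ^ 2 := by
      rw [← CStarRing.norm_star_mul_self]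
      exact norm_le_of_le_smul_one (star_mul_self_nonneg z) (sq_nonneg κ) h6
    exact abs_le_of_sq_le_sq' (by nlinarith) hκ |>.2
  have h4 : directSum x y ≤ w + κ • (1 : CStarMatrix _ _ A) := by
    refine le_add_of_norm_sub_le (.of_nonneg (directSum_nonneg hx hy)) hwsa ?_
    rwa [hwz, sub_sub_cancel_left, norm_neg]
  have h5 : directSum x y ≤ v.conjTranspose * (τ⁻¹ • a) * v +
      (τ + κ) • (1 : CStarMatrix _ _ A) := by
    refine h4.trans ((add_le_add h3 le_rfl).trans (le_of_eq ?_))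
    rw [add_smul, add_assoc]
  rw [cls_add_cls, ← cutDown_directSum (.of_nonneg hx) (.of_nonneg hy)]
  refine Below.trans (b := τ⁻¹ • a) ?_ (Below.smul_le (inv_nonneg.2 hτ.le) a)
  refine Below.cutDown_of_le (.of_nonneg (directSum_nonneg hx hy)) v.conjTranspose ?_
  rwa [Mat.conjTranspose_conjTranspose]

end Orthogonal

open scoped CStarAlgebra

/-! ### Scalar matrices and entrywise application of completely positive maps -/

section ScalarMatrices

variable {A : Type*} [CStarAlgebra A] {n : Type*} [DecidableEq n]

/-- The scalar matrix `diag(c, …, c)`. -/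
def scalarMat (n : Type*) [DecidableEq n] (c : A) : CStarMatrix n n A :=
  CStarMatrix.ofMatrix fun i j => if i = j then c else 0

theorem scalarMat_apply (c : A) (i j : n) : scalarMat n c i j = if i = j then c else 0 := rfl

theorem scalarMat_mul [Fintype n] (c d : A) : scalarMat n c * scalarMat n d = scalarMat n (c * d) := by
  refine CStarMatrix.ext fun i j => ?_
  simp only [CStarMatrix.mul_apply, scalarMat_apply]
  simp

theorem scalarMat_sub (c d : A) : scalarMat n (c - d) = scalarMat n c - scalarMat n d := by
  refine CStarMatrix.ext fun i j => ?_
  simp only [CStarMatrix.sub_apply, scalarMat_apply]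
  split_ifs <;> simp

theorem scalarMat_one : scalarMat n (1 : A) = 1 := rfl

theorem scalarMat_conjTranspose (c : A) :
    (scalarMat n c).conjTranspose = scalarMat n (star c) := by
  refine CStarMatrix.ext fun i j => ?_
  rw [CStarMatrix.conjTranspose_apply, scalarMat_apply, scalarMat_apply]
  rcases eq_or_ne i j with rfl | hij
  · simp
  · simp [hij, hij.symm]

end ScalarMatrices

section Amplification

variable {A B : Type*} [CStarAlgebra A] [PartialOrder A] [StarOrderedRing A]
  [CStarAlgebra B] [PartialOrder B] [StarOrderedRing B]
variable {l m n o : Type*}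

/-- Entrywise application of a completely positive map to a matrix. -/
noncomputable def amp (φ : A →CP B) (x : CStarMatrix m n A) : CStarMatrix m n B := x.map φ

variable (φ : A →CP B)

@[simp] theorem amp_apply (x : CStarMatrix m n A) (i : m) (j : n) : amp φ x i j = φ (x i j) := rfl

theorem amp_sub (x y : CStarMatrix m n A) : amp φ (x - y) = amp φ x - amp φ y :=
  CStarMatrix.ext fun _ _ => map_sub φ _ _

theorem amp_add (x y : CStarMatrix m n A) : amp φ (x + y) = amp φ x + amp φ y :=
  CStarMatrix.ext fun _ _ => map_add φ _ _

theorem amp_zero : amp φ (0 : CStarMatrix m n A) = 0 :=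
  CStarMatrix.ext fun _ _ => map_zero φ

theorem map_real_smul (t : ℝ) (x : A) : φ (t • x) = t • φ x := by
  rw [← Complex.coe_smul, map_smul, Complex.coe_smul]

theorem amp_smul (t : ℝ) (x : CStarMatrix m n A) : amp φ (t • x) = t • amp φ x :=
  CStarMatrix.ext fun _ _ => map_real_smul φ t _

theorem amp_conjTranspose (x : CStarMatrix m n A) :
    amp φ x.conjTranspose = (amp φ x).conjTranspose :=
  CStarMatrix.ext fun _ _ => map_star φ _

theorem amp_directSum {n m : ℕ} (a : CStarMatrix (Fin n) (Fin n) A)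
    (b : CStarMatrix (Fin m) (Fin m) A) :
    amp φ (directSum a b) = directSum (amp φ a) (amp φ b) := by
  refine CStarMatrix.ext fun i j => ?_
  rw [amp_apply, directSum_apply, directSum_apply]
  refine Fin.addCases (fun i => ?_) (fun i => ?_) i <;>
    refine Fin.addCases (fun j => ?_) (fun j => ?_) j <;> simp

theorem amp_copies {n : ℕ} (b : CStarMatrix (Fin n) (Fin n) A) (k : ℕ) :
    amp φ (copies b k) = copies (amp φ b) k := by
  induction k with
  | zero => exact amp_zero φ
  | succ k ih => rw [copies, amp_directSum, ih]; rfl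

variable [Fintype l] [Fintype m] [Fintype n]

theorem amp_nonneg {x : CStarMatrix n n A} (hx : 0 ≤ x) : 0 ≤ amp φ x :=
  φ.map_cstarMatrix_nonneg x hx

theorem amp_mono {x y : CStarMatrix n n A} (h : x ≤ y) : amp φ x ≤ amp φ y := by
  rw [← sub_nonneg, ← amp_sub]
  exact amp_nonneg φ (sub_nonneg.2 h)

omit [Fintype n] in
theorem amp_isSelfAdjoint {x : CStarMatrix n n A} (hx : IsSelfAdjoint x) :
    IsSelfAdjoint (amp φ x) := by
  have h := amp_conjTranspose φ x
  have h' : x.conjTranspose = x := hx.star_eq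
  rw [h'] at h
  exact h.symm

variable [DecidableEq n]

theorem scalarMat_nonneg {c : A} (hc : 0 ≤ c) : 0 ≤ scalarMat n c := by
  obtain ⟨s, rfl⟩ := exists_eq_star_mul_self hc
  rw [← scalarMat_mul, ← scalarMat_conjTranspose]
  exact star_mul_self_nonneg _

omit [Fintype n] in
theorem amp_one : amp φ (1 : CStarMatrix n n A) = scalarMat n (φ 1) := by
  refine CStarMatrix.ext fun i j => ?_
  rw [amp_apply, CStarMatrix.one_apply, scalarMat_apply]
  split_ifs <;> simp

theorem map_one_nonneg : 0 ≤ φ 1 := map_nonneg φ zero_le_one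

theorem map_one_le (hφ : IsContractive φ) : φ 1 ≤ 1 := by
  have h : ‖φ 1‖ ≤ 1 := by
    rcases subsingleton_or_nontrivial A with hA | hA
    · rw [Subsingleton.elim (1 : A) 0, map_zero, norm_zero]
      exact zero_le_one
    · exact (hφ 1).trans_eq norm_one
  exact (CStarAlgebra.norm_le_one_iff_of_nonneg _ (map_one_nonneg φ)).1 h

theorem amp_one_le (hφ : IsContractive φ) : amp φ (1 : CStarMatrix n n A) ≤ 1 := by
  rw [amp_one, ← scalarMat_one, ← sub_nonneg, ← scalarMat_sub]
  exact scalarMat_nonneg (sub_nonneg.2 (map_one_le φ hφ))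

theorem amp_smul_one_le (hφ : IsContractive φ) {t : ℝ} (ht : 0 ≤ t) :
    amp φ (t • (1 : CStarMatrix n n A)) ≤ t • (1 : CStarMatrix n n B) := by
  rw [amp_smul]
  exact smul_le_smul_of_nonneg_left (amp_one_le φ hφ) ht

theorem amp_le_add (hφ : IsContractive φ) {x y : CStarMatrix n n A} {t : ℝ} (ht : 0 ≤ t)
    (h : x ≤ y + t • (1 : CStarMatrix n n A)) :
    amp φ x ≤ amp φ y + t • (1 : CStarMatrix n n B) := by
  refine (amp_mono φ h).trans ?_
  rw [amp_add]
  exact add_le_add le_rfl (amp_smul_one_le φ hφ ht)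

end Amplification

/-! ### Asymptotic multiplicativity at the level of matrices -/

section Limits

variable {A B : Type*} [CStarAlgebra A] [PartialOrder A] [StarOrderedRing A]
  [CStarAlgebra B] [PartialOrder B] [StarOrderedRing B]
variable {l m n o : Type*} [Fintype l] [Fintype m] [Fintype n]

omit [PartialOrder A] [StarOrderedRing A] [Fintype m] [Fintype n] in
theorem tendsto_matrix_iff {x : ℕ → CStarMatrix m n A} {y : CStarMatrix m n A} :
    Tendsto x atTop (𝓝 y) ↔ ∀ i j, Tendsto (fun k => x k i j) atTop (𝓝 (y i j)) := by
  have h : Tendsto x atTop (𝓝 y) ↔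
      Tendsto (fun k i j => x k i j) atTop (𝓝 (fun i j => y i j)) := Iff.rfl
  exact h.trans (tendsto_pi_nhds.trans (forall_congr' fun i => tendsto_pi_nhds))

variable {β : ℕ → (B →CP A)} (hβ : ∀ j, IsContractive (β j))
  (hmul : ∀ x y : B, Tendsto (fun j => ‖β j (x * y) - β j x * β j y‖) atTop (𝓝 0))

omit [Fintype l] [Fintype n] in
include hmul in
theorem tendsto_amp_mul (x : CStarMatrix l m B) (y : CStarMatrix m n B) :
    Tendsto (fun j => amp (β j) (x * y) - amp (β j) x * amp (β j) y) atTop (𝓝 0) := by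
  rw [tendsto_matrix_iff]
  intro i k
  have h : ∀ j, (amp (β j) (x * y) - amp (β j) x * amp (β j) y) i k =
      ∑ p, (β j (x i p * y p k) - β j (x i p) * β j (y p k)) := by
    intro j
    rw [CStarMatrix.sub_apply, amp_apply, CStarMatrix.mul_apply, CStarMatrix.mul_apply, map_sum,
      ← Finset.sum_sub_distrib]
    rfl
  simp only [h]
  have h0 : (0 : CStarMatrix l n A) i k = ∑ _p : m, (0 : A) := by simp [CStarMatrix.zero_apply]
  rw [h0]
  exact tendsto_finsetSum _ fun p _ => tendsto_zero_iff_norm_tendsto_zero.2 (hmul _ _)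

-- Contractivity bounds `amp (β j) y` entrywise, uniformly in `j`, so a null sequence stays null
-- after multiplication.
omit [Fintype l] [Fintype n] in
include hβ in
theorem tendsto_mul_amp {e : ℕ → CStarMatrix l m A} (he : Tendsto e atTop (𝓝 0))
    (y : CStarMatrix m n B) : Tendsto (fun j => e j * amp (β j) y) atTop (𝓝 0) := by
  rw [tendsto_matrix_iff] at he ⊢
  intro i k
  simp only [CStarMatrix.mul_apply, amp_apply]
  have h0 : (0 : CStarMatrix l n A) i k = ∑ _p : m, (0 : A) := by simp [CStarMatrix.zero_apply]
  rw [h0]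
  refine tendsto_finsetSum _ fun p _ => ?_
  have h1 : Tendsto (fun j => ‖e j i p‖ * ‖y p k‖) atTop (𝓝 0) := by
    have := (tendsto_zero_iff_norm_tendsto_zero.1 (he i p)).mul_const ‖y p k‖
    rwa [zero_mul] at this
  refine squeeze_zero_norm (fun j => ?_) h1
  exact (norm_mul_le _ _).trans (mul_le_mul_of_nonneg_left (hβ j _) (norm_nonneg _))

include hβ hmul in
theorem tendsto_amp_conj (r : CStarMatrix m n B) (x : CStarMatrix n n B) :
    Tendsto (fun j => amp (β j) (r * x * r.conjTranspose) -
      amp (β j) r * amp (β j) x * (amp (β j) r).conjTranspose) atTop (𝓝 0) := by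
  have h1 := tendsto_amp_mul hmul (r * x) r.conjTranspose
  have h2 := tendsto_mul_amp hβ (tendsto_amp_mul hmul r x) r.conjTranspose
  have h := h1.add h2
  rw [add_zero] at h
  refine h.congr fun j => ?_
  rw [Mat.sub_mul, amp_conjTranspose]
  abel

theorem eventually_norm_le {x : ℕ → CStarMatrix n n A} (hx : Tendsto x atTop (𝓝 0)) {ε : ℝ}
    (hε : 0 < ε) : ∀ᶠ j in atTop, ‖x j‖ ≤ ε := by
  have h := tendsto_zero_iff_norm_tendsto_zero.1 hx
  exact (h.eventually_lt_const hε).mono fun _ h => h.le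

end Limits

/-! ### Carrying divisors from `B` to `A` -/

section Transfer

variable {A B : Type*} [CStarAlgebra A] [PartialOrder A] [StarOrderedRing A]
  [CStarAlgebra B] [PartialOrder B] [StarOrderedRing B]

omit [PartialOrder A] [StarOrderedRing A] in
theorem Mat.conj_isSelfAdjoint {m n : Type*} [Fintype m] [Fintype n] {b : CStarMatrix n n A}
    (hb : IsSelfAdjoint b) (r : CStarMatrix m n A) : IsSelfAdjoint (r * b * r.conjTranspose) := by
  have hb' : b.conjTranspose = b := hb.star_eq
  change (r * b * r.conjTranspose).conjTranspose = _
  rw [Mat.conjTranspose_mul, Mat.conjTranspose_mul, Mat.conjTranspose_conjTranspose, hb',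
    Mat.mul_assoc]

theorem Mat.le_cutDown_add {n : Type*} [Fintype n] [DecidableEq n] {x : CStarMatrix n n A}
    (hx : IsSelfAdjoint x) (δ : ℝ) : x ≤ cutDown x δ + δ • (1 : CStarMatrix n n A) :=
  AsympTracial.le_cutDown_add hx δ

variable {β : ℕ → (B →CP A)} (hβ : ∀ j, IsContractive (β j))
  (hmul : ∀ x y : B, Tendsto (fun j => ‖β j (x * y) - β j x * β j y‖) atTop (𝓝 0))

include hβ hmul in
/-- Approximate divisors can be carried along asymptotically multiplicative maps. -/
theorem AlmostDivisible.eventually_exists {m : ℕ} (hB : AlmostDivisible m B) {n : ℕ}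
    {c : CStarMatrix (Fin n) (Fin n) B} (hc : 0 ≤ c) (k : ℕ) {η : ℝ} (hη : 0 < η) :
    ∀ᶠ j in atTop, ∃ (p : ℕ) (b : CStarMatrix (Fin p) (Fin p) A), 0 ≤ b ∧
      k • cls b ≤ cls (cutDown (amp (β j) c) η) ∧
      cls (cutDown (amp (β j) c) (5 * η)) ≤ ((k + 1) * (m + 1)) • cls b := by
  have hcsa : IsSelfAdjoint c := .of_nonneg hc
  obtain ⟨p, b, hb, h1, h2⟩ := hB n (cutDown c η) (cutDown_nonneg c η) k η hη
  rw [matCuntzLE_iff_below] at h1 h2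
  set L := (k + 1) * (m + 1)
  have hcut : 0 ≤ cutDown c η := cutDown_nonneg c η
  obtain ⟨s, hs⟩ := h2.exists_near hη
  have hbL : 0 ≤ copies b L := copies_nonneg hb L
  -- The `3η` consists of two successive cut-downs and one approximation error.
  have hupper : c ≤ s * copies b L * s.conjTranspose +
      (3 * η) • (1 : CStarMatrix (Fin n) (Fin n) B) := by
    have e1 : c ≤ cutDown c η + η • (1 : CStarMatrix (Fin n) (Fin n) B) := le_cutDown_add hcsa η
    have e2 : cutDown c η ≤ cutDown (cutDown c η) η + η • (1 : CStarMatrix (Fin n) (Fin n) B) :=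
      le_cutDown_add (.of_nonneg hcut) η
    have e3 : cutDown (cutDown c η) η ≤ s * copies b L * s.conjTranspose +
        η • (1 : CStarMatrix (Fin n) (Fin n) B) :=
      le_add_of_norm_sub_le (.of_nonneg (cutDown_nonneg _ η))
        (.of_nonneg (Mat.conj_nonneg hbL s)) hs.le
    have e4 : (3 * η) • (1 : CStarMatrix (Fin n) (Fin n) B) = η • 1 + η • 1 + η • 1 := by
      rw [← add_smul, ← add_smul]
      congr 1
      ring
    calc c ≤ _ := e1
      _ ≤ _ := add_le_add (e2.trans (add_le_add e3 le_rfl)) le_rfl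
      _ = _ := by rw [e4]; abel
  -- `T` will bound `β(s) β(s)*` for late `j`, so cutting `β(b)` down by `2δ` costs at most `2δT =
  -- η` after conjugation by `β(s)`.
  set T := ‖s * s.conjTranspose‖ + 1 with hT
  have hT0 : 0 < T := by positivity
  set δ := η / (2 * T) with hδ_def
  have hδ : 0 < δ := by positivity
  -- Comparison with `c - η·1`, which need not be positive, replaces comparison with `cutDown c η`:
  -- it is affine in `c`, so conjugates of it pass through `β j` up to small errors.
  obtain ⟨r, hr⟩ := (h1.trans (Below.cutDown_sub hcsa η)).exists_near hδ
  have hcη : IsSelfAdjoint (c - η • (1 : CStarMatrix (Fin n) (Fin n) B)) :=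
    hcsa.sub (isSelfAdjoint_smul_one η)
  have hlower : copies b k ≤ r * (c - η • (1 : CStarMatrix (Fin n) (Fin n) B)) * r.conjTranspose +
      δ • (1 : CStarMatrix (Fin (p * k)) (Fin (p * k)) B) :=
    le_add_of_norm_sub_le (.of_nonneg (copies_nonneg hb k)) (Mat.conj_isSelfAdjoint hcη r) hr.le
  have t1 := tendsto_amp_conj hβ hmul r c
  have t2 := (tendsto_amp_mul hmul r r.conjTranspose).const_smul η
  rw [smul_zero] at t2
  have t3 := t1.sub t2
  rw [sub_zero] at t3
  filter_upwards [eventually_norm_le t3 hδ,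
    eventually_norm_le (tendsto_amp_conj hβ hmul s (copies b L)) hη,
    eventually_norm_le (tendsto_amp_mul hmul s s.conjTranspose) one_pos] with j j1 j2 j3
  set F := β j
  have hFb : 0 ≤ amp F b := amp_nonneg F hb
  have hFc : IsSelfAdjoint (amp F c) := .of_nonneg (amp_nonneg F hc)
  -- The cut by `2δ` pays for the error `δ` in `hlower` and the multiplicativity error `δ` of `β j`.
  refine ⟨p, cutDown (amp F b) (2 * δ), cutDown_nonneg _ _, ?_, ?_⟩
  · rw [← cls_copies, ← cutDown_copies hFb]
    refine Below.cutDown_of_le (.of_nonneg (copies_nonneg hFb k)) (amp F r) ?_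
    have e1 := amp_le_add F (hβ j) hδ.le hlower
    rw [amp_copies] at e1
    set x := amp F (r * (c - η • (1 : CStarMatrix (Fin n) (Fin n) B)) * r.conjTranspose) with hx
    set y := amp F r * (amp F c - η • (1 : CStarMatrix (Fin n) (Fin n) A)) *
      (amp F r).conjTranspose with hy
    have exy : x - y = amp F (r * c * r.conjTranspose) -
        amp F r * amp F c * (amp F r).conjTranspose -
        η • (amp F (r * r.conjTranspose) - amp F r * amp F r.conjTranspose) := by
      rw [hx, hy, Mat.mul_sub, Mat.sub_mul, amp_sub, CStarMatrix.mul_smul, CStarMatrix.smul_mul,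
        Mat.mul_one, amp_smul, Mat.mul_sub, Mat.sub_mul, CStarMatrix.mul_smul,
        CStarMatrix.smul_mul, Mat.mul_one, amp_conjTranspose, smul_sub]
      abel
    have e2 : x ≤ y + δ • (1 : CStarMatrix (Fin (p * k)) (Fin (p * k)) A) := by
      refine le_add_of_norm_sub_le (amp_isSelfAdjoint F (Mat.conj_isSelfAdjoint hcη r))
        (Mat.conj_isSelfAdjoint (hFc.sub (isSelfAdjoint_smul_one η)) _) ?_
      exact le_of_eq_of_le (congrArg norm exy) j1
    have e3 : y ≤ amp F r * cutDown (amp F c) η * (amp F r).conjTranspose :=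
      Mat.conj_le_conj (sub_le_cutDown hFc η) _
    calc copies (amp F b) k ≤ _ := e1
      _ ≤ _ := add_le_add (e2.trans (add_le_add e3 le_rfl)) le_rfl
      _ = _ := by rw [two_mul, add_smul, add_assoc]
  · rw [← cls_copies, ← cutDown_copies hFb]
    refine Below.cutDown_of_le hFc (amp F s) ?_
    have hY : 0 ≤ copies (amp F b) L := copies_nonneg hFb L
    have e1 := amp_le_add F (hβ j) (by positivity) hupper
    have e2 : amp F (s * copies b L * s.conjTranspose) ≤
        amp F s * copies (amp F b) L * (amp F s).conjTranspose +
          η • (1 : CStarMatrix (Fin n) (Fin n) A) := by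
      rw [← amp_copies]
      refine le_add_of_norm_sub_le (amp_isSelfAdjoint F (.of_nonneg (Mat.conj_nonneg hbL s)))
        (Mat.conj_isSelfAdjoint ?_ _) j2
      rw [amp_copies]
      exact .of_nonneg hY
    have e3 := Mat.conj_le_conj
      (Mat.le_cutDown_add (x := copies (amp F b) L) (.of_nonneg hY) (2 * δ)) (amp F s)
    rw [CStarMatrix.mul_add, CStarMatrix.add_mul, CStarMatrix.mul_smul, CStarMatrix.smul_mul,
      Mat.mul_one] at e3
    have hss : 0 ≤ s * s.conjTranspose := by
      have := Mat.conjTranspose_mul_self_nonneg s.conjTranspose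
      rwa [Mat.conjTranspose_conjTranspose] at this
    have hFss : 0 ≤ amp F s * (amp F s).conjTranspose := by
      have := Mat.conjTranspose_mul_self_nonneg (amp F s).conjTranspose
      rwa [Mat.conjTranspose_conjTranspose] at this
    have e4 : amp F s * (amp F s).conjTranspose ≤ T • (1 : CStarMatrix (Fin n) (Fin n) A) := by
      have f1 : amp F s * (amp F s).conjTranspose ≤ amp F (s * s.conjTranspose) +
          (1 : ℝ) • (1 : CStarMatrix (Fin n) (Fin n) A) := by
        refine le_add_of_norm_sub_le (.of_nonneg hFss) (.of_nonneg (amp_nonneg F hss)) ?_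
        rw [norm_sub_rev, ← amp_conjTranspose]
        exact j3
      have f2 : s * s.conjTranspose ≤
          ‖s * s.conjTranspose‖ • (1 : CStarMatrix (Fin n) (Fin n) B) :=
        le_smul_one_of_norm_le (.of_nonneg hss) le_rfl
      have f3 := (amp_mono F f2).trans (amp_smul_one_le F (hβ j) (norm_nonneg _))
      refine f1.trans ((add_le_add f3 le_rfl).trans (le_of_eq ?_))
      rw [← add_smul]
    have e5 : (2 * δ) • (amp F s * (amp F s).conjTranspose) ≤
        η • (1 : CStarMatrix (Fin n) (Fin n) A) := by
      refine (smul_le_smul_of_nonneg_left e4 (by positivity)).trans (le_of_eq ?_)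
      rw [smul_smul]
      congr 1
      rw [hδ_def]
      field_simp
    -- The total loss is `3η` from `hupper`, `η` from multiplicativity and `η` from the cut-down of
    -- `β(b)`.
    have e6 : (5 * η) • (1 : CStarMatrix (Fin n) (Fin n) A) =
        η • 1 + η • 1 + (3 * η) • 1 := by
      rw [← add_smul, ← add_smul]
      congr 1
      ring
    calc amp F c ≤ _ := e1
      _ ≤ _ := add_le_add (e2.trans (add_le_add (e3.trans (add_le_add le_rfl e5)) le_rfl)) le_rfl
      _ = _ := by rw [e6]; abel

end Transfer

/-! ### Matrix entries: comparison, positivity and norms -/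

section Entries

variable {A : Type*} [CStarAlgebra A] {n : ℕ}

theorem continuous_scalarMat {n : Type*} [DecidableEq n] :
    Continuous (scalarMat n : A → CStarMatrix n n A) := by
  have h : Continuous fun (c : A) (i j : n) => if i = j then c else 0 := by
    refine continuous_pi fun i => continuous_pi fun j => ?_
    split_ifs
    · exact continuous_id
    · exact continuous_const
  exact h

theorem Below.scalarMat_of_cuntzLE {c d : A} (h : CuntzLE c d) :
    Below (scalarMat (Fin 1) c) (scalarMat (Fin 1) d) := by
  refine map_mem_closure (f := scalarMat (Fin 1)) continuous_scalarMat
    (cuntzLE_iff_mem_closure.1 h) ?_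
  rintro _ ⟨r, rfl⟩
  refine ⟨scalarMat (Fin 1) r, ?_⟩
  change scalarMat (Fin 1) r * scalarMat (Fin 1) d * (scalarMat (Fin 1) r).conjTranspose = _
  rw [scalarMat_conjTranspose, scalarMat_mul, scalarMat_mul]

theorem Below.scalarMat_entry (b : CStarMatrix (Fin n) (Fin n) A) (i : Fin n) :
    Below (scalarMat (Fin 1) (b i i)) b := by
  refine .of_eq (incl fun _ => i) ?_
  refine CStarMatrix.ext fun x y => ?_
  simp [CStarMatrix.mul_apply, incl_apply, CStarMatrix.conjTranspose_apply, scalarMat_apply,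
    Subsingleton.elim x y, apply_ite star]

/-- A scalar matrix is a sum of `n` matrices with the single entry `c`, each below `c`; this is the
origin of the factor `n` in the bound on the remainder. -/
theorem cls_scalarMat_le (c : A) :
    cls (scalarMat (Fin n) c) ≤ n • cls (scalarMat (Fin 1) c) := by
  set f : Fin n → CStarMatrix (Fin 1) (Fin n) A := fun i => incl fun _ => i with hf
  have h : scalarMat (Fin n) c =
      ∑ i, (f i).conjTranspose * scalarMat (Fin 1) c * f i := by
    refine CStarMatrix.ext fun x y => ?_
    have hsum : ∀ g : Fin n → CStarMatrix (Fin n) (Fin n) A, (∑ i, g i) x y = ∑ i, g i x y :=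
      fun g => Matrix.sum_apply x y Finset.univ g
    rw [hsum]
    simp [CStarMatrix.mul_apply, hf, incl_apply, CStarMatrix.conjTranspose_apply, scalarMat_apply,
      apply_ite star, eq_comm]
  rw [h]
  refine (cls_sum_le _ _).trans ?_
  refine (Finset.sum_le_card_nsmul Finset.univ _ (cls (scalarMat (Fin 1) c)) fun i _ => ?_).trans ?_
  · exact Below.of_eq (f i).conjTranspose (by rw [Mat.conjTranspose_conjTranspose])
  · rw [Finset.card_univ, Fintype.card_fin]

theorem eq_zero_of_cls_le_zero {a : CStarMatrix (Fin n) (Fin n) A} (h : cls a ≤ 0) :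
    a = 0 := by
  have h' : Below a (0 : CStarMatrix (Fin 0) (Fin 0) A) := h
  have hsub : (Set.range fun r : CStarMatrix (Fin n) (Fin 0) A =>
      r * (0 : CStarMatrix (Fin 0) (Fin 0) A) * r.conjTranspose) ⊆ {0} := by
    rintro _ ⟨r, rfl⟩
    simp only [CStarMatrix.mul_zero, CStarMatrix.zero_mul, Set.mem_singleton_iff]
  simpa using closure_minimal hsub isClosed_singleton h'

variable [PartialOrder A] [StarOrderedRing A]

theorem entry_nonneg {b : CStarMatrix (Fin n) (Fin n) A} (hb : 0 ≤ b) (i : Fin n) :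
    0 ≤ b i i := by
  obtain ⟨s, rfl⟩ := exists_eq_star_mul_self hb
  rw [CStarMatrix.mul_apply]
  exact Finset.sum_nonneg fun k _ => by
    rw [CStarMatrix.star_apply]
    exact star_mul_self_nonneg _

/-- A diagonal entry of `s* s` is a sum of squares of one column of `s`, so vanishing of the whole
diagonal forces `s = 0`. -/
theorem exists_entry_ne_zero {b : CStarMatrix (Fin n) (Fin n) A} (hb : 0 ≤ b) (h0 : b ≠ 0) :
    ∃ i, b i i ≠ 0 := by
  contrapose! h0
  obtain ⟨s, rfl⟩ := exists_eq_star_mul_self hb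
  have hs : s = 0 := by
    refine CStarMatrix.ext fun k i => ?_
    have h := h0 i
    rw [CStarMatrix.mul_apply, Finset.sum_eq_zero_iff_of_nonneg] at h
    · have := h k (Finset.mem_univ k)
      rw [CStarMatrix.star_apply] at this
      exact (CStarRing.star_mul_self_eq_zero_iff _).1 this
    · intro j _
      rw [CStarMatrix.star_apply]
      exact star_mul_self_nonneg _
  rw [hs, mul_zero]

/-- The norm topology on matrices is that of entrywise convergence; a counterexample for each
`1/(k+1)` would give a null sequence bounded away from zero. -/
theorem exists_forall_entry_norm_lt (n : ℕ) {δ : ℝ} (hδ : 0 < δ) :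
    ∃ ρ > 0, ∀ x : CStarMatrix (Fin n) (Fin n) A, (∀ i j, ‖x i j‖ < ρ) → ‖x‖ ≤ δ := by
  by_contra! hcon
  choose x hx hx' using fun k : ℕ => hcon (1 / ((k : ℝ) + 1)) (by positivity)
  have h : Tendsto x atTop (𝓝 0) := by
    rw [tendsto_matrix_iff]
    intro i j
    exact squeeze_zero_norm (fun k => (hx k i j).le) tendsto_one_div_add_atTop_nhds_zero_nat
  obtain ⟨k, hk⟩ := (eventually_norm_le h hδ).exists
  exact (hx' k).not_ge hk

theorem le_norm_smul_one {a : CStarMatrix (Fin n) (Fin n) A} (ha : 0 ≤ a) :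
    a ≤ ‖a‖ • (1 : CStarMatrix (Fin n) (Fin n) A) :=
  le_smul_one_of_norm_le (.of_nonneg ha) le_rfl

theorem amp_le_norm_smul {B : Type*} [CStarAlgebra B] [PartialOrder B] [StarOrderedRing B]
    (φ : A →CP B) {a : CStarMatrix (Fin n) (Fin n) A} (ha : 0 ≤ a) :
    amp φ a ≤ ‖a‖ • amp φ (1 : CStarMatrix (Fin n) (Fin n) A) := by
  rw [← amp_smul]
  exact amp_mono φ (le_norm_smul_one ha)

theorem Mat.cutDown_le_cutDown {a b : CStarMatrix (Fin n) (Fin n) A} (ha : 0 ≤ a) (hb : 0 ≤ b)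
    {s t δ : ℝ} (h : a ≤ b + s • (1 : CStarMatrix (Fin n) (Fin n) A)) (hst : s + t ≤ δ) :
    cls (cutDown a δ) ≤ cls (cutDown b t) := by
  refine Below.cutDown_of_le' (.of_nonneg ha) ?_
  calc a ≤ _ := h
    _ ≤ _ := add_le_add (Mat.le_cutDown_add (.of_nonneg hb) t) le_rfl
    _ = cutDown b t + (s + t) • (1 : CStarMatrix (Fin n) (Fin n) A) := by rw [add_smul]; abel
    _ ≤ _ := add_le_add le_rfl (smul_le_smul_of_nonneg_right hst zero_le_one)

end Entries

/-! ### Splitting a positive matrix, and the two-round argument -/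

section Main

variable {A : Type u} [CStarAlgebra A] [PartialOrder A] [StarOrderedRing A]
  {P : (B : Type v) → [CStarAlgebra B] → [PartialOrder B] → [StarOrderedRing B] → Prop} {m n : ℕ}

/-- A positive matrix splits approximately as the sum of a divisible part and a part that is small
in the sense of Cuntz comparison. -/
theorem AsymptoticallyTraciallyIn.exists_splitting
    (hP : ∀ (B : Type v) [CStarAlgebra B] [PartialOrder B] [StarOrderedRing B],
      P B → AlmostDivisible m B)
    (hA : AsymptoticallyTraciallyIn P A) {a : CStarMatrix (Fin n) (Fin n) A} (ha : 0 ≤ a)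
    {d : A} (hd : 0 ≤ d) (hd0 : d ≠ 0) (k : ℕ) {η τ : ℝ} (hη : 0 < η) (hτ : 0 < τ) :
    ∃ (x y : CStarMatrix (Fin n) (Fin n) A) (p : ℕ) (b : CStarMatrix (Fin p) (Fin p) A),
      0 ≤ x ∧ 0 ≤ y ∧ 0 ≤ b ∧
      ‖a - (x + y)‖ ≤ τ ∧
      k • cls b ≤ cls (cutDown x η) ∧
      cls (cutDown x (5 * η)) ≤ ((k + 1) * (m + 1)) • cls b ∧
      cls y ≤ n • cls (scalarMat (Fin 1) d) ∧
      (∀ i, ‖a i i‖ - τ ≤ ‖x i i‖) ∧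
      ∃ s t : CStarMatrix (Fin n) (Fin n) A, IsSelfAdjoint s ∧ IsSelfAdjoint t ∧
        s * s = x ∧ t * t = y ∧ ‖s * t‖ ≤ τ := by
  classical
  set M := ‖a‖
  have hM : 0 ≤ M := norm_nonneg a
  -- Chosen so that `M²(ζ + ζ) ≤ τ²`, where the two `ζ` bound `‖E - E²‖` and the excess of `E + G`
  -- over 1. The `+ 1` covers `M = 0`.
  set ζ := min τ (τ ^ 2 / (2 * (M * M + 1))) with hζ_def
  have hζ : 0 < ζ := by positivity
  have hζτ : ζ ≤ τ := min_le_left _ _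
  have hζM : M * (M * (ζ + ζ)) ≤ τ ^ 2 := by
    have h : ζ * (2 * (M * M + 1)) ≤ τ ^ 2 :=
      (le_div_iff₀ (by positivity)).1 (min_le_right _ _)
    nlinarith
  obtain ⟨ρ, hρ, hρζ⟩ := exists_forall_entry_norm_lt (A := A) n hζ
  -- Both halvings serve two-step estimates: `E² ≈ E` loses `ε` through `α` and again through `β j`,
  -- and the norm of a diagonal entry loses `τ/2` in each.
  set ε := min (ρ / 2) (τ / 2) with hε_def
  have hε : 0 < ε := by positivity
  have hερ : ε ≤ ρ / 2 := min_le_left _ _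
  have hετ : ε ≤ τ / 2 := min_le_right _ _
  obtain ⟨B, _, _, _, α, β, γ, hPB, hα, hβ, hγ, happ, hemb, hmul, hnorm, hγd⟩ :=
    -- The elements 0 and 1 are included so that the same estimate applies to the identity matrix.
    hA ε hε (insert 0 (insert 1 (Finset.univ.image fun p : Fin n × Fin n => a p.1 p.2))) d hd hd0
  have hmem : ∀ i j, a i j ∈
      insert 0 (insert 1 (Finset.univ.image fun p : Fin n × Fin n => a p.1 p.2)) := fun i j =>
    Finset.mem_insert_of_mem (Finset.mem_insert_of_mem
      (Finset.mem_image.2 ⟨(i, j), Finset.mem_univ _, rfl⟩))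
  have hmem1 : (1 : A) ∈
      insert 0 (insert 1 (Finset.univ.image fun p : Fin n × Fin n => a p.1 p.2)) :=
    Finset.mem_insert_of_mem (Finset.mem_insert_self _ _)
  have hmem0 : (0 : A) ∈
      insert 0 (insert 1 (Finset.univ.image fun p : Fin n × Fin n => a p.1 p.2)) :=
    Finset.mem_insert_self _ _
  have hone : ∀ j, ‖β j (α 1 * α 1) - β j (α 1)‖ < ε := by
    intro j
    have h := hemb.1 1 hmem1 1 hmem1
    rw [mul_one] at h
    rw [← map_sub]
    refine (hβ j _).trans_lt ?_
    rwa [norm_sub_rev]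
  have hent : ∀ i, ∀ᶠ j in atTop, ‖a i i‖ - τ ≤ ‖β j (α (a i i))‖ := by
    intro i
    have h := abs_lt.1 (hemb.2 _ (hmem i i))
    filter_upwards [(hnorm (α (a i i))).eventually_const_lt
      (show ‖α (a i i)‖ - τ / 2 < ‖α (a i i)‖ by linarith)] with j hj
    linarith [h.1]
  have hproj : ∀ᶠ j in atTop, ‖β j (α 1 * α 1) - β j (α 1) * β j (α 1)‖ < ε :=
    (hmul _ _).eventually_lt_const hε
  obtain ⟨j, ⟨p, b, hb, hb1, hb2⟩, hentj, hprojj⟩ :=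
    (((hP B hPB).eventually_exists hβ hmul (amp_nonneg α ha) k hη).and
      ((eventually_all.2 hent).and hproj)).exists
  have hsplit : ∀ z : CStarMatrix (Fin n) (Fin n) A, (∀ i l, z i l ∈
      insert 0 (insert 1 (Finset.univ.image fun p : Fin n × Fin n => a p.1 p.2))) →
      ‖z - (amp (β j) (amp α z) + amp (γ j) z)‖ ≤ ζ := by
    intro z hz
    refine hρζ _ fun i l => ?_
    have h := happ _ (hz i l) j
    have e : (z - (amp (β j) (amp α z) + amp (γ j) z)) i l =
        z i l - γ j (z i l) - β j (α (z i l)) := by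
      rw [CStarMatrix.sub_apply, CStarMatrix.add_apply, amp_apply, amp_apply, amp_apply]
      abel
    rw [e]
    linarith
  set E := amp (β j) (amp α (1 : CStarMatrix (Fin n) (Fin n) A)) with hE_def
  set G := amp (γ j) (1 : CStarMatrix (Fin n) (Fin n) A) with hG_def
  have hE : 0 ≤ E := amp_nonneg _ (amp_nonneg _ zero_le_one)
  have hG : 0 ≤ G := amp_nonneg _ zero_le_one
  have hE1 : E ≤ 1 := (amp_mono _ (amp_one_le α hα)).trans (amp_one_le _ (hβ j))
  have hEG : E + G ≤ 1 + ζ • (1 : CStarMatrix (Fin n) (Fin n) A) := by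
    refine le_add_of_norm_sub_le (.of_nonneg (add_nonneg hE hG)) (.one _) ?_
    rw [norm_sub_rev]
    refine hsplit 1 fun i l => ?_
    rw [CStarMatrix.one_apply]
    split_ifs
    · exact hmem1
    · exact hmem0
  have hEE : ‖E - E * E‖ ≤ ζ := by
    have e1 : E = scalarMat (Fin n) (β j (α 1)) := by
      refine CStarMatrix.ext fun i l => ?_
      rw [hE_def, amp_one, amp_apply, scalarMat_apply, scalarMat_apply]
      split_ifs <;> simp
    rw [e1, scalarMat_mul, ← scalarMat_sub]
    refine hρζ _ fun i l => ?_
    rw [scalarMat_apply]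
    split_ifs
    · calc ‖β j (α 1) - β j (α 1) * β j (α 1)‖
          ≤ ‖β j (α 1) - β j (α 1 * α 1)‖ + ‖β j (α 1 * α 1) - β j (α 1) * β j (α 1)‖ :=
            norm_sub_le_norm_sub_add_norm_sub _ _ _
        _ < ε + ε := add_lt_add (by rw [norm_sub_rev]; exact hone j) hprojj
        _ ≤ ρ := by linarith
    · rwa [norm_zero]
  have hx : 0 ≤ amp (β j) (amp α a) := amp_nonneg _ (amp_nonneg _ ha)
  have hy : 0 ≤ amp (γ j) a := amp_nonneg _ ha
  have hxE : amp (β j) (amp α a) ≤ M • E := by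
    rw [hE_def, ← amp_smul]
    exact amp_mono _ (amp_le_norm_smul α ha)
  have hyG : amp (γ j) a ≤ M • G := amp_le_norm_smul (γ j) ha
  refine ⟨amp (β j) (amp α a), amp (γ j) a, p, b, hx, hy, hb, (hsplit a hmem).trans hζτ, hb1, hb2,
    ?_, hentj, ?_⟩
  -- The matrix `γ(a)` is at most `M diag(γ(1), …, γ(1))`, hence below `n` copies of `γ(1) ≾ d`.
  · calc cls (amp (γ j) a) ≤ cls (M • G) := Below.of_le hy hyG
      _ ≤ cls G := Below.smul_le hM G
      _ ≤ n • cls (scalarMat (Fin 1) (γ j 1)) := by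
        rw [hG_def, amp_one]
        exact cls_scalarMat_le _
      _ ≤ _ := nsmul_le_nsmul_right (Below.scalarMat_of_cuntzLE (hγd j)) n
  · refine exists_sqrt_norm_mul_le hx hy hE hG hE1 hM hζ.le hτ.le hxE hyG hEG (le_trans ?_ hζM)
    gcongr

/-- The class `P` may consist of algebras in another universe than `A`. -/
theorem AsymptoticallyTraciallyIn.almostDivisible [Nontrivial A]
    (hP : ∀ (B : Type v) [CStarAlgebra B] [PartialOrder B] [StarOrderedRing B],
      P B → AlmostDivisible m B)
    (hA : AsymptoticallyTraciallyIn P A) : AlmostDivisible m A := by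
  intro n a ha k ε hε
  simp only [matCuntzLE_iff_below, ← cls_le_cls, cls_copies]
  by_cases ha0 : a = 0
  · refine ⟨0, 0, le_rfl, ?_, ?_⟩
    · rw [cls_zero, nsmul_zero]
      exact CuntzClass.zero_le _
    · have h : cutDown a ε = 0 := by
        refine cutDown_eq_zero_of_le (.of_nonneg ha) ?_
        rw [ha0]
        exact smul_nonneg hε.le zero_le_one
      rw [h, cls_zero]
      exact nsmul_nonneg (CuntzClass.zero_le _) _
  obtain ⟨i, hi⟩ := exists_entry_ne_zero ha ha0
  have hi0 : 0 < ‖a i i‖ := norm_pos_iff.2 hi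
  set η := min (ε / 20) (‖a i i‖ / 20) with hη_def
  have hη : 0 < η := by positivity
  have hηε : η ≤ ε / 20 := min_le_left _ _
  have hηi : η ≤ ‖a i i‖ / 20 := min_le_right _ _
  have hτ : 0 < η / 4 := by positivity
  obtain ⟨x, y, p, b₁, hx, hy, hb₁, hxy, hb₁x, hxb₁, -, hxi, s, t, hs, ht, hss, htt, hst⟩ :=
    -- Smallness of `y` is not needed in this round, so `d = 1`; the factor `n + 1` reserves room
    -- for the second remainder.
    hA.exists_splitting hP ha zero_le_one one_ne_zero (k * (n + 1)) hη hτ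
  -- If `b₁` vanished then `x ≤ 5η`, whereas `‖x i i‖ ≥ ‖a i i‖ - η/4` and `‖a i i‖ ≥ 20η`.
  have hb₁0 : b₁ ≠ 0 := by
    intro h
    rw [h, cls_zero, nsmul_zero] at hxb₁
    have h1 := eq_zero_of_cls_le_zero hxb₁
    have h2 := Mat.le_cutDown_add (.of_nonneg hx) (5 * η)
    rw [h1, zero_add] at h2
    have h3 := entry_nonneg (sub_nonneg.2 h2) i
    rw [CStarMatrix.sub_apply, CStarMatrix.smul_apply, CStarMatrix.one_apply_eq, sub_nonneg] at h3
    have h4 := norm_le_of_le_smul_one (entry_nonneg hx i) (by positivity) h3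
    have h5 := hxi i
    linarith
  obtain ⟨l, hl⟩ := exists_entry_ne_zero hb₁ hb₁0
  obtain ⟨z, w, q, b₂, hz, hw, hb₂, hzw, hb₂z, hzb₂, hwd, -, -⟩ :=
    -- The test element is now an entry of `b₁`, so `w` is controlled by `n⟨b₁⟩`. Orthogonality of
    -- `z` and `w` is not needed, since `w` enters only the upper estimate.
    hA.exists_splitting hP hy (entry_nonneg hb₁ l) hl k hη hτ
  have hwb : cls w ≤ n • cls b₁ :=
    hwd.trans (nsmul_le_nsmul_right (Below.scalarMat_entry b₁ l) n)
  have e1 : a ≤ x + y + (η / 4) • (1 : CStarMatrix (Fin n) (Fin n) A) :=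
    le_add_of_norm_sub_le (.of_nonneg ha) (.of_nonneg (add_nonneg hx hy)) hxy
  have e2 : x + y ≤ a + (η / 4) • (1 : CStarMatrix (Fin n) (Fin n) A) :=
    le_add_of_norm_sub_le (.of_nonneg (add_nonneg hx hy)) (.of_nonneg ha)
      (by rwa [norm_sub_rev])
  have e3 : y ≤ z + w + (η / 4) • (1 : CStarMatrix (Fin n) (Fin n) A) :=
    le_add_of_norm_sub_le (.of_nonneg hy) (.of_nonneg (add_nonneg hz hw)) hzw
  have e4 : z ≤ y + (η / 4) • (1 : CStarMatrix (Fin n) (Fin n) A) :=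
    (le_add_of_nonneg_right hw).trans (le_add_of_norm_sub_le (.of_nonneg (add_nonneg hz hw))
      (.of_nonneg hy) (by rwa [norm_sub_rev]))
  refine ⟨_, directSum (copies b₁ (n + 1)) b₂, directSum_nonneg (copies_nonneg hb₁ _) hb₂, ?_, ?_⟩
  · rw [← cls_add_cls, cls_copies, nsmul_add, ← mul_nsmul']
    calc _ ≤ cls (cutDown x η) + cls (cutDown z η) := add_le_add hb₁x hb₂z
      -- As `z ≤ y + η/4`, cutting `z` by `η` leaves something below the cut of `y` by `η/2`, which
      -- is the level required for `x` and `y` to fit together below `a`.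
      _ ≤ cls (cutDown x (η / 4 + η / 4)) + cls (cutDown y (η / 4 + η / 4)) := by
        refine add_le_add (Mat.cutDown_le_cutDown hx hx (s := 0) ?_ (by linarith))
          (Mat.cutDown_le_cutDown hz hy e4 (by linarith))
        rw [zero_smul, add_zero]
      _ ≤ cls a := cls_cutDown_add_cls_cutDown_le hx hy hτ hτ.le e2 hs ht hss htt hst
  · rw [← cls_add_cls, cls_copies, nsmul_add, ← mul_nsmul']
    have f1 : cls (cutDown a ε) ≤ cls (cutDown x (5 * η) + (cutDown z (5 * η) + w)) := by
      refine Below.cutDown_of_le' (.of_nonneg ha) ?_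
      have g1 := Mat.le_cutDown_add (.of_nonneg hx) (5 * η)
      have g2 := Mat.le_cutDown_add (.of_nonneg hz) (5 * η)
      calc a ≤ _ := e1
        _ ≤ _ := add_le_add (add_le_add g1 (e3.trans (add_le_add (add_le_add g2 le_rfl) le_rfl)))
          le_rfl
        _ = cutDown x (5 * η) + (cutDown z (5 * η) + w) +
            (5 * η + 5 * η + η / 4 + η / 4) • (1 : CStarMatrix (Fin n) (Fin n) A) := by
          simp only [add_smul]
          abel
        _ ≤ _ := add_le_add le_rfl (smul_le_smul_of_nonneg_right (by linarith) zero_le_one)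
    have f2 : cls (cutDown a ε) ≤ ((k * (n + 1) + 1) * (m + 1)) • cls b₁ +
        (((k + 1) * (m + 1)) • cls b₂ + n • cls b₁) :=
      f1.trans ((cls_add_le _ _).trans (add_le_add hxb₁
        ((cls_add_le _ _).trans (add_le_add hzb₂ hwb))))
    refine f2.trans ?_
    rw [add_comm (((k + 1) * (m + 1)) • cls b₂), ← add_assoc, ← add_nsmul]
    refine add_le_add (nsmul_le_nsmul_left (CuntzClass.zero_le _) ?_) le_rfl
    -- The right side exceeds the left by exactly `n m`.
    nlinarith [Nat.zero_le (n * m)]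

end Main

end AsympTracial

theorem theorem3p1 (m : ℕ)
    (P : (B : Type v) → [CStarAlgebra B] → [PartialOrder B] → [StarOrderedRing B] → Prop)
    (hP : ∀ (B : Type v) [CStarAlgebra B] [PartialOrder B] [StarOrderedRing B],
      P B → AsympTracial.AlmostDivisible m B)
    (A : Type u) [CStarAlgebra A] [PartialOrder A] [StarOrderedRing A]
    (hsep : TopologicalSpace.SeparableSpace A) (hsimple : AsympTracial.IsSimpleCStar A)
    (hA : AsympTracial.AsymptoticallyTraciallyIn P A) :
    AsympTracial.AlmostDivisible m A :=
  have := hsimple.1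
  hA.almostDivisible hP
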